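/- **Setting.** Let $\Omega\subset\mathbb R^d$ be compact and convex. For probability measures $\mu,\nu$ on $\mathbb R^d$ let $\mathrm W(\mu,\nu)=\inf_\pi\big(\int|x-y|^2\,d\pi(x,y)\big)^{1/2}$, the infimum over all couplings $\pi$ of $\mu$ and $\nu$, be the Wasserstein-2 distance. For a curve $\rho$ of probability measures on $\Omega$, $t\in[0,1]$, that is Lipschitz for $\mathrm W$, let $\mathrm{CE}(\rho)$ be the set of measurable families of fields $v(t)\in L^2(\rho(t);\mathbb R^d)$ with $$\int_0^1\!\!\int\partial_t\phi\,d\rho(t)\,dt+\int_0^1\!\!\int\langle\nabla\phi(t,\cdot),v(t)\rangle\,d\rho(t)\,dt=\int\phi(1,\cdot)\,d\rho(1)-\int\phi(0,\cdot)\,d\rho(0)$$ for all $C^1$ functions $\phi(t,x)$, and let $\mathrm{energy}(\rho)=\inf_{v\in \mathrm{CE}(\rho)}\int_0^1\|v(t)\|^2_{L^2(\rho(t))}\,dt$. For a set $\Lambda$ of probability measures on $\Omega$ and $\mu,\nu\in\Lambda$ let $$\mathrm W_\Lambda(\mu,\nu)=\inf\{\mathrm{energy}(\rho)^{1/2} :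 \rho\in\mathrm{Lip}([0,1];(\Lambda,\mathrm W)),\ \rho(0)=\mu,\ \rho(1)=\nu\}.$$ **Assumptions.** (i) *Parameter manifold.* $\mathcal S$ is a compact connected finite-dimensional smooth Riemannian manifold; it may have a boundary, in which case it is a geodesically convex subset of a larger smooth Riemannian manifold without boundary. Denote by $d_{\mathcal S}$ the induced distance (infimum of the lengths of paths in $\mathcal S$). $\mathcal D$ is a set of tangent vectors $(\theta,\eta)$ at points $\theta \in \mathcal S$ on which the exponential map is well-defined, such that $(\theta,\eta)\in\mathcal D$ implies $(\theta,t\eta)\in\mathcal D$ for $t\in[0,1]$, and such that for $(\theta,\eta)\in\mathcal D$ the curve $\gamma(t)=\exp_\theta(t\eta)$, $t\in[0,1]$, is a constant speed geodesic in $\mathcal S$ with $\|\dot\gamma(t)\|_{\gamma(t)}=\|\eta\|_\theta=d_{\mathcal S}(\theta,\exp_\theta(\eta))$. For all $\theta_0,\theta_1\in\mathcal S$ there is $\eta$ with $(\theta_0,\eta)\in\mathcal D$ and $\exp_{\theta_0}(\eta)=\theta_1$. Write $\mathcal D_\theta=\{\eta:(\theta,\eta)\in\mathcal D\}$. (ii)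 *Embedding.* $E:\mathcal S\to\mathcal P(\Omega)$, $\theta\mapsto\lambda_\theta$, is bi-Lipschitz for $d_{\mathcal S}$ and $\mathrm W$ onto its image $\Lambda=E(\mathcal S)$, and every $\lambda_\theta$ is absolutely continuous with respect to the Lebesgue measure. (iii) *Velocity fields.* For each $\theta\in\mathcal S$, $B_\theta$ is a linear map from $T_\theta\mathcal S$ to the $C^1$ gradient vector fields on $\mathbb R^d$, and there is $C_0\in(0,\infty)$ such that for all $(\theta,\eta)\in\mathcal D$, $x\in\mathbb R^d$, $t\in[0,1]$, with $\gamma(t)=\exp_\theta(t\eta)$, $$\tfrac1{C_0}\|\eta\|_\theta\le\|B_\theta\eta\|_{L^2(\lambda_\theta)}\le C_0\|\eta\|_\theta,\qquad \|B_\theta\eta\|_{C^1(\mathbb R^d)}\le C_0\|\eta\|_\theta,\qquad \big|\partial_t[B_{\gamma(t)}\dot\gamma(t)](x)\big|\le C_0\|\eta\|_\theta^2 .$$ (iv) *Consistency.* For every Lipschitz curve $\gamma:[0,1]\to(\mathcal S,d_{\mathcal S})$, the flow $\varphi$ on $[0,1]\times\Omega$ given by $\varphi(0,\cdot)=\mathrm{id}$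 and $\partial_t\varphi(t,\cdot)=[B_{\gamma(t)}\dot\gamma(t)](\varphi(t,\cdot))$ for a.e. $t$ satisfies $\lambda_{\gamma(t)}=\varphi(t,\cdot)_\#\lambda_{\gamma(0)}$ for all $t\in[0,1]$. **Theorem.** There is a constant $C\in(0,\infty)$ such that for every $\theta\in\mathcal S$ and all $\eta_1,\eta_2\in\mathcal D_\theta$, with $\gamma_i(t)=\exp_\theta(t\eta_i)$, $t\in[0,1]$, the distance $\mathrm W_\Lambda(\lambda_{\gamma_1(t)},\lambda_{\gamma_2(t)})$ is finite and $$\Big|\mathrm W_\Lambda(\lambda_{\gamma_1(t)},\lambda_{\gamma_2(t)})-t\,\|B_\theta(\eta_1-\eta_2)\|_{L^2(\lambda_\theta)}\Big|\le C\,t^2\,(\|\eta_1\|_\theta+\|\eta_2\|_\theta)^2$$ for all $t\in\big[0,\min\{1,\tfrac1{C\|\eta_1\|_\theta},\tfrac1{C\|\eta_2\|_\theta}\}\big)$ (with $\tfrac10=\infty$). Moreover, the (one-sided) derivative at $t=0$ exists and $$\frac{d}{dt}\,\mathrm W_\Lambda(\lambda_{\gamma_1(t)},\lambda_{\gamma_2(t)})\Big|_{t=0}=\|B_\theta(\eta_1-\eta_2)\|_{L^2(\lambda_\theta)}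 .$$ -/

import Mathlib

open Set MeasureTheory Manifold Bundle
open scoped ContDiff ENNReal NNReal Topology

noncomputable section

namespace WassersteinSubmanifold

/-- Euclidean space of dimension `n`. -/
abbrev Eucl (n : ℕ) : Type := EuclideanSpace ℝ (Fin n)

/-! ### Wasserstein distance, energy of curves, geodesic restriction -/

section Wasserstein

variable {d : ℕ}

/-- The Wasserstein-2 distance, as an extended number: the square root of the infimum of
`∫ |x - y|² dκ` over all measures `κ` with first marginal `μ` and second marginal `ν`. -/
def wassEDist (μ ν : Measure (Eucl d)) : ℝ≥0∞ :=
  (⨅ (κ : Measure (Eucl d × Eucl d)) (_ : κ.map Prod.fst = μ) (_ : κ.map Prod.snd = ν),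
    ∫⁻ p, ‖p.1 - p.2‖ₑ ^ 2 ∂κ) ^ (1 / 2 : ℝ)

/-- `v ∈ CE(ρ)`: the velocity fields `v t ∈ L²(ρ t)` are (jointly) measurable and satisfy the
continuity equation with `ρ` on `[0,1]`, tested against all `C¹` functions of `(t, x)`. -/
structure IsContinuityEq (ρ : ℝ → Measure (Eucl d)) (v : ℝ → Eucl d → Eucl d) : Prop where
  measurable : Measurable (fun p : ℝ × Eucl d => v p.1 p.2)
  memLp : ∀ t ∈ Icc (0 : ℝ) 1, MemLp (v t) 2 (ρ t)
  eq : ∀ φ : ℝ × Eucl d → ℝ, ContDiff ℝ 1 φ →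
    (∫ t in (0 : ℝ)..1, ∫ x, deriv (fun s => φ (s, x)) t ∂(ρ t)) +
      (∫ t in (0 : ℝ)..1, ∫ x, inner ℝ (gradient (fun y => φ (t, y)) x) (v t x) ∂(ρ t)) =
    (∫ x, φ (1, x) ∂(ρ 1)) - ∫ x, φ (0, x) ∂(ρ 0)

/-- `energy(ρ)`: the infimum of `∫₀¹ ‖v t‖²_{L²(ρ t)} dt` over `v ∈ CE(ρ)`. -/
def energy (ρ : ℝ → Measure (Eucl d)) : ℝ≥0∞ :=
  ⨅ (v : ℝ → Eucl d → Eucl d) (_ : IsContinuityEq ρ v),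
    ∫⁻ t in Icc (0 : ℝ) 1, ∫⁻ x, ‖v t x‖ₑ ^ 2 ∂(ρ t)

/-- `ρ ∈ Lip([0,1]; (Λ, W))`. -/
def IsLipCurveIn (L : Set (Measure (Eucl d))) (ρ : ℝ → Measure (Eucl d)) : Prop :=
  (∀ t ∈ Icc (0 : ℝ) 1, ρ t ∈ L) ∧
    ∃ K : ℝ≥0, ∀ s ∈ Icc (0 : ℝ) 1, ∀ t ∈ Icc (0 : ℝ) 1,
      wassEDist (ρ s) (ρ t) ≤ K * edist s t

/-- The geodesic restriction `W_Λ` of the Wasserstein distance to a set `L` of measures. -/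
def geodRestrEDist (L : Set (Measure (Eucl d))) (μ ν : Measure (Eucl d)) : ℝ≥0∞ :=
  ⨅ (ρ : ℝ → Measure (Eucl d)) (_ : IsLipCurveIn L ρ) (_ : ρ 0 = μ) (_ : ρ 1 = ν),
    energy ρ ^ (1 / 2 : ℝ)

end Wasserstein

/-! ### Riemannian geometry: velocities, intrinsic distance, geodesics, exponential map -/

section Riemannian

variable {F : Type*} [NormedAddCommGroup F] [NormedSpace ℝ F]
  {M : Type*} [TopologicalSpace M] [ChartedSpace F M]

/-- The velocity `γ̇(t)` of a curve on `[0,1]` (one-sided at the endpoints). -/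
def velocity (F : Type*) [NormedAddCommGroup F] [NormedSpace ℝ F]
    {M : Type*} [TopologicalSpace M] [ChartedSpace F M]
    (γ : ℝ → M) (t : ℝ) : TangentSpace 𝓘(ℝ, F) (γ t) :=
  mfderivWithin 𝓘(ℝ, ℝ) 𝓘(ℝ, F) γ (Icc 0 1) t (1 : ℝ)

variable [RiemannianBundle (fun x : M => TangentSpace 𝓘(ℝ, F) x)]

/-- The distance `d_S` induced on `S ⊆ M` by the Riemannian metric: the infimum of the lengths of
the `C¹` paths contained in `S`. -/
def intrinsicEDist (F : Type*) [NormedAddCommGroup F] [NormedSpace ℝ F]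
    {M : Type*} [TopologicalSpace M] [ChartedSpace F M]
    [RiemannianBundle (fun x : M => TangentSpace 𝓘(ℝ, F) x)] (S : Set M) (x y : M) : ℝ≥0∞ :=
  ⨅ (γ : ℝ → M) (_ : ContMDiffOn 𝓘(ℝ, ℝ) 𝓘(ℝ, F) 1 γ (Icc 0 1)) (_ : MapsTo γ (Icc 0 1) S)
    (_ : γ 0 = x) (_ : γ 1 = y), pathELength 𝓘(ℝ, F) γ 0 1

/-- The coordinate expression at `y`, in the chart at `p`, of the Riemannian metric:
`(a, b) ↦ ∑ g_{ij}(y) a^i b^j`. -/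
def chartMetric (p : M) (y a b : F) : ℝ :=
  inner ℝ (mfderiv 𝓘(ℝ, F) 𝓘(ℝ, F) (extChartAt 𝓘(ℝ, F) p).symm y a)
    (mfderiv 𝓘(ℝ, F) 𝓘(ℝ, F) (extChartAt 𝓘(ℝ, F) p).symm y b)

/-- `γ : [0,1] → M` is a geodesic: it is smooth and, in every chart, its coordinates `x(t)` solve
`ẍ^k + Γ^k_{ij}(x) ẋ^i ẋ^j = 0`. The equation is written with the upper index lowered, that is,
paired through the metric with an arbitrary coordinate vector `w`; the Christoffel symbols then
contribute `(∂_ẋ g)(ẋ, w) - ½ (∂_w g)(ẋ, ẋ)`. -/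
structure IsGeodesic (γ : ℝ → M) : Prop where
  smooth : ContMDiffOn 𝓘(ℝ, ℝ) 𝓘(ℝ, F) ∞ γ (Icc 0 1)
  equation : ∀ t ∈ Icc (0 : ℝ) 1, ∀ p : M, γ t ∈ (chartAt F p).source → ∀ w : F,
    let x : ℝ → F := fun s => extChartAt 𝓘(ℝ, F) p (γ s)
    let x' : F := derivWithin x (Icc 0 1) t
    let x'' : F := iteratedDerivWithin 2 x (Icc 0 1) t
    chartMetric p (x t) x'' w + fderiv ℝ (fun y => chartMetric p y x' w) (x t) x'
      - (1 / 2) * fderiv ℝ (fun y => chartMetric p y x' x') (x t) w = 0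

/-- `γ : [0,1] → M` is a geodesic with `γ(0) = θ` and `γ̇(0) = η`. -/
def IsGeodesicFrom (θ : M) (η : TangentSpace 𝓘(ℝ, F) θ) (γ : ℝ → M) : Prop :=
  IsGeodesic (F := F) γ ∧
    (⟨γ 0, velocity F γ 0⟩ : TangentBundle 𝓘(ℝ, F) M) = ⟨θ, η⟩

open Classical in
/-- The Riemannian exponential map: `exp_θ(η) = γ(1)` for the geodesic `γ` on `[0,1]` with
`γ(0) = θ` and `γ̇(0) = η` (with the value `θ` where there is no such geodesic). -/
def riemExp (θ : M) (η : TangentSpace 𝓘(ℝ, F) θ) : M :=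
  if h : ∃ γ : ℝ → M, IsGeodesicFrom θ η γ then h.choose 1 else θ

/-- The curve `t ↦ exp_θ(t η)`. -/
def expCurve (θ : M) (η : TangentSpace 𝓘(ℝ, F) θ) (t : ℝ) : M := riemExp θ (t • η)

/-- `γ ∈ Lip([0,1]; (S, d_S))`. -/
def IsLipCurveOn (F : Type*) [NormedAddCommGroup F] [NormedSpace ℝ F]
    {M : Type*} [TopologicalSpace M] [ChartedSpace F M]
    [RiemannianBundle (fun x : M => TangentSpace 𝓘(ℝ, F) x)] (S : Set M) (γ : ℝ → M) : Prop :=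
  MapsTo γ (Icc 0 1) S ∧
    ∃ K : ℝ≥0, ∀ s ∈ Icc (0 : ℝ) 1, ∀ t ∈ Icc (0 : ℝ) 1,
      intrinsicEDist F S (γ s) (γ t) ≤ K * edist s t

end Riemannian

/-! ### Parametrized submanifolds of Wasserstein space -/

section Main

variable {d : ℕ} {F : Type*} [NormedAddCommGroup F] [NormedSpace ℝ F]
  {M : Type*} [TopologicalSpace M] [ChartedSpace F M]
  [RiemannianBundle (fun x : M => TangentSpace 𝓘(ℝ, F) x)]

/-- `φ : [0,1] × Ω → ℝᵈ` is a flow of the time dependent field `v`: each `φ(·, x)` is absolutely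
continuous, `φ(0, ·) = id`, and `∂ₜ φ(t, ·) = v(t, φ(t, ·))` for a.e. `t`; the maps `φ(t, ·)` are
measurable with respect to `μ`, so that the push-forward of `μ` makes sense. -/
structure IsFlow (Ω : Set (Eucl d)) (μ : Measure (Eucl d)) (v : ℝ → Eucl d → Eucl d)
    (φ : ℝ → Eucl d → Eucl d) : Prop where
  init : ∀ x ∈ Ω, φ 0 x = x
  absCont : ∀ x ∈ Ω, AbsolutelyContinuousOnInterval (fun t => φ t x) 0 1
  ode : ∀ᵐ t ∂(volume.restrict (Icc (0 : ℝ) 1)), ∀ x ∈ Ω,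
    HasDerivWithinAt (fun s => φ s x) (v t (φ t x)) (Icc 0 1) t
  aemeasurable : ∀ t ∈ Icc (0 : ℝ) 1, AEMeasurable (φ t) μ

/-- The parameter manifold. `S` is a compact connected subset of a Riemannian manifold `M`
without boundary (`S = M` if the parameter manifold has no boundary; otherwise `S` is a
geodesically convex subset of the larger manifold `M`), and `D` is a set of tangent vectors
`(θ, η)`, star-shaped in `η`, on which the exponential map is well-defined and such that
`t ↦ exp_θ(t η)` is a constant speed geodesic in `S` of length `‖η‖ = d_S(θ, exp_θ(η))`; any two
points of `S` are joined by one of these geodesics. -/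
structure IsParameterManifold (S : Set M) (D : Set (TangentBundle 𝓘(ℝ, F) M)) : Prop where
  isCompact : IsCompact S
  isConnected : IsConnected S
  base_mem : ∀ (θ : M) (η : TangentSpace 𝓘(ℝ, F) θ),
    (⟨θ, η⟩ : TangentBundle 𝓘(ℝ, F) M) ∈ D → θ ∈ S
  smul_mem : ∀ (θ : M) (η : TangentSpace 𝓘(ℝ, F) θ),
    (⟨θ, η⟩ : TangentBundle 𝓘(ℝ, F) M) ∈ D → ∀ t ∈ Icc (0 : ℝ) 1,
      (⟨θ, t • η⟩ : TangentBundle 𝓘(ℝ, F) M) ∈ D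
  geodesic : ∀ (θ : M) (η : TangentSpace 𝓘(ℝ, F) θ),
    (⟨θ, η⟩ : TangentBundle 𝓘(ℝ, F) M) ∈ D → IsGeodesicFrom θ η (expCurve θ η)
  mapsTo : ∀ (θ : M) (η : TangentSpace 𝓘(ℝ, F) θ),
    (⟨θ, η⟩ : TangentBundle 𝓘(ℝ, F) M) ∈ D → MapsTo (expCurve θ η) (Icc 0 1) S
  speed : ∀ (θ : M) (η : TangentSpace 𝓘(ℝ, F) θ),
    (⟨θ, η⟩ : TangentBundle 𝓘(ℝ, F) M) ∈ D → ∀ t ∈ Icc (0 : ℝ) 1,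
      ‖velocity F (expCurve θ η) t‖ = ‖η‖
  minimizing : ∀ (θ : M) (η : TangentSpace 𝓘(ℝ, F) θ),
    (⟨θ, η⟩ : TangentBundle 𝓘(ℝ, F) M) ∈ D → ‖η‖ₑ = intrinsicEDist F S θ (riemExp θ η)
  exists_exp_eq : ∀ θ₀ ∈ S, ∀ θ₁ ∈ S, ∃ η : TangentSpace 𝓘(ℝ, F) θ₀,
    (⟨θ₀, η⟩ : TangentBundle 𝓘(ℝ, F) M) ∈ D ∧ riemExp θ₀ η = θ₁

/-- The embedding `E : S → P(Ω)`: a bi-Lipschitz map, from `d_S` to the Wasserstein distance, into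
the absolutely continuous probability measures on `Ω`. (Values of `E` off `S` play no role.) -/
structure IsEmbeddingOn (Ω : Set (Eucl d)) (S : Set M) (E : M → Measure (Eucl d)) : Prop where
  isProbabilityMeasure : ∀ θ ∈ S, IsProbabilityMeasure (E θ)
  concentrated : ∀ θ ∈ S, E θ Ωᶜ = 0
  absolutelyContinuous : ∀ θ ∈ S, E θ ≪ volume
  biLipschitz : ∃ L : ℝ≥0, ∀ θ₀ ∈ S, ∀ θ₁ ∈ S,
    wassEDist (E θ₀) (E θ₁) ≤ L * intrinsicEDist F S θ₀ θ₁ ∧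
    intrinsicEDist F S θ₀ θ₁ ≤ L * wassEDist (E θ₀) (E θ₁)

/-- The velocity fields: linear maps `B_θ` from the tangent space at `θ` to `C¹` gradient vector
fields on `ℝᵈ`, with the uniform bounds
`‖B_θ η‖_{L²(λ_θ)} ∈ [1/C, C] ‖η‖`, `‖B_θ η‖_{C¹} ≤ C ‖η‖` and
`|∂ₜ [B_{γ(t)} γ̇(t)](x)| ≤ C ‖η‖²`, `γ(t) = exp_θ(t η)`, for `(θ, η) ∈ D`. -/
structure IsVelocityFamily (S : Set M) (D : Set (TangentBundle 𝓘(ℝ, F) M))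
    (E : M → Measure (Eucl d))
    (B : ∀ θ : M, TangentSpace 𝓘(ℝ, F) θ →ₗ[ℝ] (Eucl d → Eucl d)) : Prop where
  contDiff : ∀ θ ∈ S, ∀ η : TangentSpace 𝓘(ℝ, F) θ, ContDiff ℝ 1 (B θ η)
  isGradient : ∀ θ ∈ S, ∀ η : TangentSpace 𝓘(ℝ, F) θ, ∃ ψ : Eucl d → ℝ,
    ∀ x, HasGradientAt ψ (B θ η x) x
  bounds : ∃ C : ℝ, 0 < C ∧ ∀ (θ : M) (η : TangentSpace 𝓘(ℝ, F) θ),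
    (⟨θ, η⟩ : TangentBundle 𝓘(ℝ, F) M) ∈ D →
      (1 / C * ‖η‖ ≤ lpNorm (B θ η) 2 (E θ) ∧ lpNorm (B θ η) 2 (E θ) ≤ C * ‖η‖) ∧
      (∀ x, ‖B θ η x‖ ≤ C * ‖η‖ ∧ ‖fderiv ℝ (B θ η) x‖ ≤ C * ‖η‖) ∧
      (∀ x, ∀ t ∈ Icc (0 : ℝ) 1, ∃ a : Eucl d,
        HasDerivWithinAt
          (fun s => B (expCurve θ η s) (velocity F (expCurve θ η) s) x) a (Icc 0 1) t ∧
        ‖a‖ ≤ C * ‖η‖ ^ 2)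

/-- Consistency of the velocity fields with the embedding: for every Lipschitz curve `γ` in `S`,
the flow `φ` of `v(t, ·) = B_{γ(t)} γ̇(t)` satisfies `λ_{γ(t)} = φ(t, ·)_# λ_{γ(0)}`. -/
def IsConsistent (Ω : Set (Eucl d)) (S : Set M) (E : M → Measure (Eucl d))
    (B : ∀ θ : M, TangentSpace 𝓘(ℝ, F) θ →ₗ[ℝ] (Eucl d → Eucl d)) : Prop :=
  ∀ γ : ℝ → M, IsLipCurveOn F S γ → ∀ φ : ℝ → Eucl d → Eucl d,
    IsFlow Ω (E (γ 0)) (fun t => B (γ t) (velocity F γ t)) φ →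
      ∀ t ∈ Icc (0 : ℝ) 1, E (γ t) = (E (γ 0)).map (φ t)

end Main

end WassersteinSubmanifold

end

/-!
Along a geodesic `γ(t) = exp_θ(t η)` the fields `v_t = B_{γ(t)} γ̇(t)` are Lipschitz in time, but
for `t > 0` only continuous in space, since `(γ(t), γ̇(t))` need not belong to `D`. Flow maps `Φ`
depending measurably on the starting point come from Peano's theorem: by compactness, Tonelli's
delayed approximations have a convergent subsequence, and it can be chosen measurably. By
consistency `λ_{γ(t)} = (Φ_t)_# λ_θ`, and `Φ_1 = id + B_θ η + O(‖η‖²)`.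

With `θ' = exp_θ η`, this gives `W_Λ(λ_θ, λ_θ') = ‖B_θ η‖ + O(‖η‖²)`. The energy of the geodesic is
an upper bound. For the lower bound, write `B_θ η = ∇ψ`: for a suitable `κ ≥ 0` the function
`ψ + (κ/2)(1 - t)|∇ψ|²` is a subsolution of the Hamilton–Jacobi equation, and testing the
continuity equation of an arbitrary competitor with it bounds the energy from below by duality.

For two tangent vectors let `θᵢ = exp_θ ηᵢ` and `exp_{θ₁} ζ = θ₂`. The transport along `η₂` and the
transport along `η₁` followed by the one along `ζ` both push `λ_θ` to `λ_{θ₂}`, so that the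
potential of the gradient field `w = B_θ η₂ - B_θ η₁ - B_{θ₁} ζ` has the same integral along both.
As the two maps differ by `w` up to second order, `‖w‖` is itself of second order in `L²(λ_θ)`,
and `‖B_{θ₁} ζ‖_{L²(λ_{θ₁})}` is `‖B_θ (η₁ - η₂)‖_{L²(λ_θ)}` up to second order.
-/

noncomputable section

namespace WassersteinSubmanifold

section Selection

open Filter

variable {X Y : Type*}

lemma exists_lt_dist_lt_and_frequently_dist_lt [PseudoMetricSpace Y] {K : Set Y}
    (hK : IsCompact K) {u : ℕ → Y} (hu : ∀ n, u n ∈ K) {a : Y} {δ ε : ℝ} (hε : 0 < ε)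
    (ha : ∃ᶠ n in atTop, dist (u n) a < δ) (N : ℕ) :
    ∃ k, N < k ∧ dist (u k) a < δ ∧ ∃ᶠ n in atTop, dist (u n) (u k) < ε := by
  have : NeBot (atTop ⊓ 𝓟 {n | dist (u n) a < δ}) := frequently_iff_neBot.1 ha
  obtain ⟨y, -, hy⟩ := hK.exists_mapClusterPt_of_frequently
    (Eventually.of_forall (f := atTop ⊓ 𝓟 {n | dist (u n) a < δ}) hu).frequently
  have hclose : ∃ᶠ n in atTop, dist (u n) a < δ ∧ dist (u n) y < ε / 2 :=
    frequently_inf_principal.1 (hy.frequently (Metric.ball_mem_nhds y (half_pos hε)))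
  obtain ⟨k, hNk, hka, hky⟩ := hclose.forall_exists_of_atTop (N + 1)
  refine ⟨k, hNk, hka, hclose.mono fun n hn => ?_⟩
  calc dist (u n) (u k) ≤ dist (u n) y + dist (u k) y := dist_triangle_right _ _ _
    _ < ε / 2 + ε / 2 := add_lt_add hn.2 hky
    _ = ε := add_halves ε

variable [MeasurableSpace X]

lemma measurable_apply_index [MeasurableSpace Y] {f : ℕ → X → Y} (hf : ∀ n, Measurable (f n))
    {N : X → ℕ} (hN : Measurable N) : Measurable fun x => f (N x) x :=
  (measurable_from_prod_countable_right (f := fun p : ℕ × X => f p.1 p.2) hf).comp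
    (hN.prodMk measurable_id)

lemma measurableSet_frequently_dist_lt [PseudoMetricSpace Y] [MeasurableSpace Y]
    [OpensMeasurableSpace Y] [SecondCountableTopology Y] {f : ℕ → X → Y}
    (hf : ∀ n, Measurable (f n)) {g : X → Y} (hg : Measurable g) (ε : ℝ) :
    MeasurableSet {x | ∃ᶠ n in atTop, dist (f n x) (g x) < ε} := by
  convert! MeasurableSet.measurableSet_limsup fun n =>
    measurableSet_lt ((hf n).dist hg) (measurable_const (a := ε))
  ext x
  simp only [mem_limsup_iff_frequently_mem, mem_ofPred_eq]

lemma exists_measurable_index_refinement [PseudoMetricSpace Y] [MeasurableSpace Y]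
    [OpensMeasurableSpace Y] [SecondCountableTopology Y] {K : Set Y} (hK : IsCompact K)
    {f : ℕ → X → Y} (hf : ∀ n, Measurable (f n)) (hfK : ∀ n x, f n x ∈ K) {δ ε : ℝ} (hε : 0 < ε)
    {N : X → ℕ} (hN : Measurable N)
    (hfreq : ∀ x, ∃ᶠ n in atTop, dist (f n x) (f (N x) x) < δ) :
    ∃ N' : X → ℕ, Measurable N' ∧ (∀ x, N x < N' x) ∧
      (∀ x, dist (f (N' x) x) (f (N x) x) < δ) ∧
      ∀ x, ∃ᶠ n in atTop, dist (f n x) (f (N' x) x) < ε := by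
  classical
  have hex := fun x => exists_lt_dist_lt_and_frequently_dist_lt hK (fun n => hfK n x) hε
    (hfreq x) (N x)
  refine ⟨fun x => Nat.find (hex x), measurable_find hex fun k => ?_,
    fun x => (Nat.find_spec (hex x)).1, fun x => (Nat.find_spec (hex x)).2.1,
    fun x => (Nat.find_spec (hex x)).2.2⟩
  exact (measurableSet_lt hN measurable_const).inter
    ((measurableSet_lt ((hf k).dist (measurable_apply_index hf hN)) measurable_const).inter
      (measurableSet_frequently_dist_lt hf (hf k) ε))

lemma exists_measurable_seq_dist_lt [PseudoMetricSpace Y] [MeasurableSpace Y]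
    [OpensMeasurableSpace Y] [SecondCountableTopology Y] {K : Set Y} (hK : IsCompact K)
    {f : ℕ → X → Y} (hf : ∀ n, Measurable (f n)) (hfK : ∀ n x, f n x ∈ K) :
    ∃ N : ℕ → X → ℕ, (∀ k, Measurable (N k)) ∧ (∀ x, StrictMono fun k => N k x) ∧
      ∀ k x, dist (f (N (k + 1) x) x) (f (N k x) x) < (1 / 2 : ℝ) ^ k := by
  let Q (k : ℕ) : Type _ := {N : X → ℕ // Measurable N ∧
    ∀ x, ∃ᶠ n in atTop, dist (f n x) (f (N x) x) < (1 / 2 : ℝ) ^ k}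
  have refine_index (k : ℕ) (N : Q k) : ∃ N' : Q (k + 1), (∀ x, N.1 x < N'.1 x) ∧
      ∀ x, dist (f (N'.1 x) x) (f (N.1 x) x) < (1 / 2 : ℝ) ^ k := by
    obtain ⟨N', hN', hlt, hdist, hfreq⟩ := exists_measurable_index_refinement hK hf hfK
      (ε := (1 / 2 : ℝ) ^ (k + 1)) (by positivity) N.2.1 N.2.2
    exact ⟨⟨N', hN', hfreq⟩, hlt, hdist⟩
  have first_index : Nonempty (Q 0) := by
    obtain ⟨N, hN, -, -, hfreq⟩ := exists_measurable_index_refinement hK hf hfK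
      (δ := Metric.diam K + 1) (ε := (1 / 2 : ℝ) ^ 0) (by positivity) (N := fun _ => 0)
      measurable_const (fun x => (Eventually.of_forall fun n =>
        (Metric.dist_le_diam_of_mem hK.isBounded (hfK n x) (hfK 0 x)).trans_lt
          (lt_add_one _)).frequently)
    exact ⟨⟨N, hN, hfreq⟩⟩
  choose next hlt hdist using refine_index
  let N : ∀ k, Q k := fun k => Nat.rec first_index.some next k
  exact ⟨fun k => (N k).1, fun k => (N k).2.1,
    fun x => strictMono_nat_of_lt_succ fun k => hlt k (N k) x, fun k => hdist k (N k)⟩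

theorem exists_measurable_subseq_limit_of_isCompact [PseudoMetricSpace Y]
    [MeasurableSpace Y] [BorelSpace Y] [SecondCountableTopology Y] {K : Set Y} (hK : IsCompact K)
    {f : ℕ → X → Y} (hf : ∀ n, Measurable (f n)) (hfK : ∀ n x, f n x ∈ K) :
    ∃ g : X → Y, Measurable g ∧ ∀ x, ∃ m : ℕ → ℕ, StrictMono m ∧
      Tendsto (fun k => f (m k) x) atTop (𝓝 (g x)) := by
  obtain ⟨N, hN, hmono, hdist⟩ := exists_measurable_seq_dist_lt hK hf hfK
  have hlim (x : X) : ∃ y ∈ K, Tendsto (fun k => f (N k x) x) atTop (𝓝 y) :=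
    cauchySeq_tendsto_of_isComplete hK.isComplete (fun k => hfK (N k x) x) <|
      cauchySeq_of_le_geometric (1 / 2) 1 one_half_lt_one
        fun k => by simpa only [one_mul, dist_comm] using (hdist k x).le
  choose g _ hg using hlim
  exact ⟨g, measurable_of_tendsto_metrizable (fun k => measurable_apply_index hf (hN k))
    (tendsto_pi_nhds.2 hg), fun x => ⟨fun k => N k x, hmono x, hg x⟩⟩

end Selection

section Peano

open Filter

variable {V : Type*} [NormedAddCommGroup V] [NormedSpace ℝ V]

/-- Tonelli's delayed approximations of the solution of `u' = v(t, u)`, `u(0) = x`: after `k` steps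
the approximation solves `u' = v(t, u(t - h))` up to time `k * h`, where `u = x` before time `0`. -/
def delayedSolution (v : ℝ × V → V) (h : ℝ) : ℕ → ℝ → V → V
  | 0, _, x => x
  | k + 1, t, x => x + ∫ s in (0 : ℝ)..max t 0, v (s, delayedSolution v h k (s - h) x)

lemma delayedSolution_apply_zero (v : ℝ × V → V) (h : ℝ) (k : ℕ) (x : V) :
    delayedSolution v h k 0 x = x := by
  cases k <;> simp [delayedSolution]

lemma continuous_delayedSolution {v : ℝ × V → V} (hv : Continuous v) (h : ℝ) (k : ℕ) :
    Continuous fun p : ℝ × V => delayedSolution v h k p.1 p.2 := by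
  induction k with
  | zero => exact continuous_snd
  | succ k ih =>
    refine continuous_snd.add ?_
    refine intervalIntegral.continuous_parametric_intervalIntegral_of_continuous
      (f := fun (p : ℝ × V) s => v (s, delayedSolution v h k (s - h) p.2)) ?_
      (continuous_fst.max continuous_const)
    have hdelay : Continuous fun q : (ℝ × V) × ℝ => (q.2 - h, q.1.2) := by fun_prop
    exact hv.comp (continuous_snd.prodMk (ih.comp hdelay))

lemma continuous_apply_delayedSolution {v : ℝ × V → V} (hv : Continuous v) (h : ℝ) (k : ℕ)
    (x : V) : Continuous fun s => v (s, delayedSolution v h k (s - h) x) :=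
  hv.comp <| continuous_id.prodMk <| (continuous_delayedSolution hv h k).comp <|
    (continuous_id.sub continuous_const).prodMk continuous_const

lemma delayedSolution_succ_of_le (v : ℝ × V → V) {h : ℝ} (hh : 0 ≤ h) (x : V) (k : ℕ) :
    ∀ t ≤ k * h, delayedSolution v h (k + 1) t x = delayedSolution v h k t x := by
  induction k with
  | zero =>
    intro t ht
    simp [delayedSolution, max_eq_right (show t ≤ 0 by simpa using ht)]
  | succ k ih =>
    intro t ht
    rw [delayedSolution, delayedSolution]
    congr 1
    refine intervalIntegral.integral_congr fun s hs => ?_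
    rw [uIcc_of_le (le_max_right t 0)] at hs
    have hs' : s - h ≤ k * h := by
      push_cast at ht
      have : 0 ≤ k * h := by positivity
      rcases le_max_iff.1 hs.2 with hst | hs0 <;> linarith
    simp only [ih _ hs']

lemma delayedSolution_eq_add_integral (v : ℝ × V → V) {h : ℝ} (hh : 0 ≤ h) (x : V) (k : ℕ) {t : ℝ}
    (ht : t ∈ Icc 0 (k * h)) :
    delayedSolution v h k t x =
      x + ∫ s in (0 : ℝ)..t, v (s, delayedSolution v h k (s - h) x) := by
  rw [← delayedSolution_succ_of_le v hh x k t ht.2, delayedSolution, max_eq_left ht.1]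

lemma lipschitzWith_delayedSolution {v : ℝ × V → V} (hv : Continuous v) {C : ℝ≥0}
    (hC : ∀ p, ‖v p‖ ≤ C) (h : ℝ) (k : ℕ) (x : V) :
    LipschitzWith C fun t => delayedSolution v h k t x := by
  cases k with
  | zero => exact (LipschitzWith.const x).weaken zero_le
  | succ k =>
    refine LipschitzWith.of_dist_le_mul fun t s => ?_
    have hint (a b : ℝ) := (continuous_apply_delayedSolution hv h k x).intervalIntegrable
      (μ := volume) a b
    rw [dist_eq_norm, delayedSolution, delayedSolution, add_sub_add_left_eq_sub,
      intervalIntegral.integral_interval_sub_left (hint _ _) (hint _ _)]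
    exact (intervalIntegral.norm_integral_le_of_norm_le_const fun s _ => hC _).trans
      (mul_le_mul_of_nonneg_left (abs_max_sub_max_le_abs t s 0) C.2)

lemma eq_add_integral_of_tendsto_delayedSolution {ι : Type*} {l : Filter ι} [NeBot l]
    [IsCountablyGenerated l] {v : ℝ × V → V} (hv : Continuous v) {C : ℝ≥0} (hC : ∀ p, ‖v p‖ ≤ C)
    {T : ℝ} {h : ι → ℝ} (hh : ∀ i, 0 ≤ h i) (hh0 : Tendsto h l (𝓝 0)) {k : ι → ℕ}
    (hkh : ∀ i, T ≤ k i * h i) {x : V} {u : ℝ → V}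
    (hu : ∀ t ∈ Icc 0 T, Tendsto (fun i => delayedSolution v (h i) (k i) t x) l (𝓝 (u t))) :
    ∀ t ∈ Icc 0 T, u t = x + ∫ s in (0 : ℝ)..t, v (s, u s) := by
  have hdelayed (s : ℝ) (hs : s ∈ Icc 0 T) :
      Tendsto (fun i => delayedSolution v (h i) (k i) (s - h i) x) l (𝓝 (u s)) := by
    refine (hu s hs).congr_dist <| squeeze_zero (fun _ => dist_nonneg) (g := fun i => C * h i)
      (fun i => ?_) (by simpa using hh0.const_mul (C : ℝ))
    simpa [Real.dist_eq, abs_of_nonneg (hh i)] using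
      (lipschitzWith_delayedSolution hv hC (h i) (k i) x).dist_le_mul s (s - h i)
  intro t ht
  have hint : Tendsto
      (fun i => ∫ s in (0 : ℝ)..t, v (s, delayedSolution v (h i) (k i) (s - h i) x)) l
      (𝓝 (∫ s in (0 : ℝ)..t, v (s, u s))) := by
    refine intervalIntegral.tendsto_integral_filter_of_dominated_convergence (fun _ => C)
      (.of_forall fun i => (continuous_apply_delayedSolution hv _ _ x).aestronglyMeasurable)
      (.of_forall fun i => .of_forall fun s _ => hC _) intervalIntegrable_const
      (.of_forall fun s hs => ?_)
    rw [uIoc_of_le ht.1] at hs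
    exact (hv.tendsto _).comp
      (tendsto_const_nhds.prodMk_nhds (hdelayed s ⟨hs.1.le, hs.2.trans ht.2⟩))
  refine tendsto_nhds_unique (hu t ht) ((hint.const_add x).congr fun i => ?_)
  exact (delayedSolution_eq_add_integral v (hh i) x (k i) ⟨ht.1, ht.2.trans (hkh i)⟩).symm

lemma isCompact_setOf_lipschitzWith_mapsTo {X Y : Type*} [PseudoEMetricSpace X] [MetricSpace Y]
    (K : ℝ≥0) {s : Set Y} (hs : IsCompact s) :
    IsCompact {u : C(X, Y) | LipschitzWith K u ∧ ∀ x, u x ∈ s} := by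
  refine ArzelaAscoli.isCompact_of_equicontinuous _ ?_
    (LipschitzWith.uniformEquicontinuous _ K fun u => u.2.1).equicontinuous
  convert! (isCompact_univ_pi fun _ : X => hs).inter_left
    (isClosed_setOfPred_lipschitzWith (α := X) (β := Y) (K := K)) using 1
  ext u
  simp only [mem_image, mem_ofPred_eq, mem_inter_iff, mem_univ_pi]
  constructor
  · rintro ⟨u, hu, rfl⟩
    exact hu
  · exact fun hu => ⟨⟨u, hu.1.continuous⟩, hu, rfl⟩

/-- The path `t ↦ u t - x` on `[0,1]`, where `u` is Tonelli's approximation starting at `x` with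
delay `1 / (n + 1)`. Subtracting the initial value keeps these paths in a fixed compact set. -/
def delayedIncrement {v : ℝ × V → V} (hv : Continuous v) (n : ℕ) (x : V) : C(Icc (0 : ℝ) 1, V) where
  toFun t := delayedSolution v (1 / (n + 1)) (n + 1) t x - x
  continuous_toFun := ((continuous_delayedSolution hv (1 / (n + 1)) (n + 1)).comp
    (continuous_subtype_val.prodMk continuous_const)).sub continuous_const

lemma continuous_delayedIncrement {v : ℝ × V → V} (hv : Continuous v) (n : ℕ) :
    Continuous (delayedIncrement hv n) :=
  ContinuousMap.continuous_of_continuous_uncurry _ <|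
    ((continuous_delayedSolution hv (1 / (n + 1)) (n + 1)).comp
      ((continuous_subtype_val.comp continuous_snd).prodMk continuous_fst)).sub continuous_fst

lemma lipschitzWith_delayedIncrement {v : ℝ × V → V} (hv : Continuous v) {C : ℝ≥0}
    (hC : ∀ p, ‖v p‖ ≤ C) (n : ℕ) (x : V) : LipschitzWith C (delayedIncrement hv n x) := by
  refine LipschitzWith.of_dist_le_mul fun s t => ?_
  simpa [delayedIncrement, Subtype.dist_eq] using
    (lipschitzWith_delayedSolution hv hC (1 / (n + 1)) (n + 1) x).dist_le_mul (s : ℝ) t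

lemma delayedIncrement_mem_closedBall {v : ℝ × V → V} (hv : Continuous v) {C : ℝ≥0}
    (hC : ∀ p, ‖v p‖ ≤ C) (n : ℕ) (x : V) (t : Icc (0 : ℝ) 1) :
    delayedIncrement hv n x t ∈ Metric.closedBall 0 (C : ℝ) := by
  have h0 : delayedIncrement hv n x 0 = 0 := by
    simp [delayedIncrement, delayedSolution_apply_zero]
  calc dist (delayedIncrement hv n x t) 0 ≤ C * dist t 0 :=
        h0 ▸ (lipschitzWith_delayedIncrement hv hC n x).dist_le_mul t 0
    _ ≤ C := mul_le_of_le_one_right C.2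
        (by simpa [Subtype.dist_eq, abs_of_nonneg t.2.1] using t.2.2)

theorem exists_measurable_solution [ProperSpace V] [MeasurableSpace V] [BorelSpace V]
    {v : ℝ × V → V} (hv : Continuous v) {C : ℝ≥0} (hC : ∀ p, ‖v p‖ ≤ C) :
    ∃ Φ : ℝ → V → V, (∀ t, Measurable (Φ t)) ∧ (∀ x, Continuous fun t => Φ t x) ∧
      ∀ x, ∀ t ∈ Icc (0 : ℝ) 1, Φ t x = x + ∫ s in (0 : ℝ)..t, v (s, Φ s x) := by
  let _ : MeasurableSpace C(Icc (0 : ℝ) 1, V) := borel _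
  have : BorelSpace C(Icc (0 : ℝ) 1, V) := ⟨rfl⟩
  obtain ⟨g, hg, hlim⟩ := exists_measurable_subseq_limit_of_isCompact
    (isCompact_setOf_lipschitzWith_mapsTo C (isCompact_closedBall (0 : V) C))
    (f := delayedIncrement hv)
    (fun n => (continuous_delayedIncrement hv n).measurable)
    (fun n x => And.intro (lipschitzWith_delayedIncrement hv hC n x)
      (delayedIncrement_mem_closedBall hv hC n x))
  let restrictTime : ℝ → Icc (0 : ℝ) 1 := projIcc 0 1 zero_le_one
  refine ⟨fun t x => x + g x (restrictTime t), fun t => measurable_id.add ?_,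
    fun x => continuous_const.add ((g x).continuous.comp continuous_projIcc), fun x => ?_⟩
  · have heval : Continuous fun u : C(Icc (0 : ℝ) 1, V) => u (restrictTime t) := by fun_prop
    exact heval.measurable.comp hg
  obtain ⟨m, hm, hmlim⟩ := hlim x
  refine eq_add_integral_of_tendsto_delayedSolution hv hC (l := atTop) (T := 1)
    (h := fun j => 1 / ((m j : ℝ) + 1)) (k := fun j => m j + 1) (fun j => by positivity)
    (tendsto_one_div_add_atTop_nhds_zero_nat.comp hm.tendsto_atTop)
    (fun j => by push_cast; field_simp; rfl) fun t ht => ?_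
  have heval : Continuous fun u : C(Icc (0 : ℝ) 1, V) => x + u (restrictTime t) := by fun_prop
  refine ((heval.tendsto _).comp hmlim).congr fun j => ?_
  simp [delayedIncrement, restrictTime, projIcc_of_mem zero_le_one ht]

end Peano

section Flow

/-- A time-dependent field, frozen outside of the time interval `[0,1]`. -/
def clampField {V : Type*} (v : ℝ → V → V) (p : ℝ × V) : V :=
  v (projIcc 0 1 zero_le_one p.1 : Icc (0 : ℝ) 1) p.2

lemma clampField_of_mem {V : Type*} (v : ℝ → V → V) {t : ℝ} (ht : t ∈ Icc (0 : ℝ) 1) (x : V) :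
    clampField v (t, x) = v t x := by
  simp [clampField, projIcc_of_mem zero_le_one ht]

variable {V : Type*} [NormedAddCommGroup V]

/-- A time-dependent field on `[0,1]` that is continuous in space and `b`-Lipschitz in time, and
that is bounded by `a` and `a`-Lipschitz at the initial time. No modulus of continuity in space is
assumed at later times, so that solutions exist but need not be unique. -/
structure IsTimeLipschitzField (v : ℝ → V → V) (a b : ℝ≥0) : Prop where
  continuous : ∀ t ∈ Icc (0 : ℝ) 1, Continuous (v t)
  lipschitz_time : ∀ x, LipschitzOnWith b (fun t => v t x) (Icc 0 1)
  norm_init_le : ∀ x, ‖v 0 x‖ ≤ a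
  lipschitz_init : LipschitzWith a (v 0)

/-- `Φ` solves the ordinary differential equation with right-hand side `v` on `[0,1]`, with
measurable dependence on the starting point. -/
structure IsSolutionMap [NormedSpace ℝ V] [MeasurableSpace V] (v : ℝ → V → V) (Φ : ℝ → V → V) :
    Prop where
  measurable : ∀ t, Measurable (Φ t)
  continuous : ∀ x, Continuous fun t => Φ t x
  eq_add_integral : ∀ x, ∀ t ∈ Icc (0 : ℝ) 1,
    Φ t x = x + ∫ s in (0 : ℝ)..t, clampField v (s, Φ s x)

variable {v : ℝ → V → V} {Φ : ℝ → V → V} {a b : ℝ≥0}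

namespace IsTimeLipschitzField

lemma continuous_clampField (hv : IsTimeLipschitzField v a b) : Continuous (clampField v) := by
  refine continuous_prod_of_continuous_lipschitzWith _ b
    (fun t => hv.continuous _ (projIcc 0 1 zero_le_one t).2) (fun x => ?_)
  have hproj : LipschitzWith 1 fun t : ℝ => (projIcc 0 1 zero_le_one t : ℝ) :=
    LipschitzWith.subtype_val _ |>.comp (LipschitzWith.projIcc zero_le_one) |>.weaken (by simp)
  have := (hv.lipschitz_time x).comp hproj.lipschitzOnWith (s := univ)
    fun t _ => (projIcc 0 1 zero_le_one t).2
  rwa [mul_one, lipschitzOnWith_univ] at this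

lemma norm_sub_init_le (hv : IsTimeLipschitzField v a b) {t : ℝ} (ht : t ∈ Icc (0 : ℝ) 1) (x : V) :
    ‖v t x - v 0 x‖ ≤ b := by
  rw [← dist_eq_norm]
  refine ((hv.lipschitz_time x).dist_le_mul t ht 0 (by simp)).trans
    (mul_le_of_le_one_right b.2 ?_)
  simpa [abs_of_nonneg ht.1] using ht.2

lemma norm_clampField_le (hv : IsTimeLipschitzField v a b) (p : ℝ × V) :
    ‖clampField v p‖ ≤ ↑(a + b) := by
  push_cast
  exact (norm_le_norm_add_norm_sub' _ (v 0 p.2)).trans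
    (add_le_add (hv.norm_init_le _) (hv.norm_sub_init_le (projIcc 0 1 zero_le_one p.1).2 _))

lemma exists_isSolutionMap [NormedSpace ℝ V] [ProperSpace V] [MeasurableSpace V] [BorelSpace V]
    (hv : IsTimeLipschitzField v a b) : ∃ Φ, IsSolutionMap v Φ := by
  obtain ⟨Φ, hmeas, hcont, heq⟩ :=
    exists_measurable_solution hv.continuous_clampField hv.norm_clampField_le
  exact ⟨Φ, hmeas, hcont, heq⟩

end IsTimeLipschitzField

namespace IsSolutionMap

variable [NormedSpace ℝ V] [MeasurableSpace V]

lemma apply_zero (hΦ : IsSolutionMap v Φ) (x : V) : Φ 0 x = x := by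
  simpa using hΦ.eq_add_integral x 0 (by simp)

lemma measurable_uncurry [BorelSpace V] (hΦ : IsSolutionMap v Φ) :
    Measurable fun p : ℝ × V => Φ p.1 p.2 :=
  measurable_uncurry_of_continuous_of_measurable (u := Φ) hΦ.continuous hΦ.measurable

lemma continuous_rhs (hΦ : IsSolutionMap v Φ) (hv : IsTimeLipschitzField v a b) (x : V) :
    Continuous fun s => clampField v (s, Φ s x) :=
  hv.continuous_clampField.comp (continuous_id.prodMk (hΦ.continuous x))

lemma hasDerivWithinAt [CompleteSpace V] (hΦ : IsSolutionMap v Φ)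
    (hv : IsTimeLipschitzField v a b) (x : V) {t : ℝ} (ht : t ∈ Icc (0 : ℝ) 1) :
    HasDerivWithinAt (fun s => Φ s x) (v t (Φ t x)) (Icc 0 1) t := by
  have hderiv : HasDerivAt (fun u => x + ∫ s in (0 : ℝ)..u, clampField v (s, Φ s x))
      (clampField v (t, Φ t x)) t :=
    ((hΦ.continuous_rhs hv x).integral_hasStrictDerivAt 0 t).hasDerivAt.const_add x
  rw [← clampField_of_mem v ht]
  exact hderiv.hasDerivWithinAt.congr (hΦ.eq_add_integral x) (hΦ.eq_add_integral x t ht)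

lemma lipschitzOnWith (hΦ : IsSolutionMap v Φ) (hv : IsTimeLipschitzField v a b) (x : V) :
    LipschitzOnWith (a + b) (fun t => Φ t x) (Icc 0 1) := by
  refine LipschitzOnWith.of_dist_le_mul fun t ht s hs => ?_
  have hint (c e : ℝ) := (hΦ.continuous_rhs hv x).intervalIntegrable (μ := volume) c e
  rw [dist_eq_norm, hΦ.eq_add_integral x t ht, hΦ.eq_add_integral x s hs,
    add_sub_add_left_eq_sub, intervalIntegral.integral_interval_sub_left (hint _ _) (hint _ _)]
  exact intervalIntegral.norm_integral_le_of_norm_le_const fun s _ => hv.norm_clampField_le _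

lemma norm_sub_le (hΦ : IsSolutionMap v Φ) (hv : IsTimeLipschitzField v a b) (x : V) {t : ℝ}
    (ht : t ∈ Icc (0 : ℝ) 1) : ‖Φ t x - x‖ ≤ a + b := by
  have hlip := (hΦ.lipschitzOnWith hv x).dist_le_mul t ht 0 (by simp)
  rw [hΦ.apply_zero, dist_eq_norm] at hlip
  refine hlip.trans (mul_le_of_le_one_right (a + b).2 ?_)
  simpa [abs_of_nonneg ht.1] using ht.2

lemma norm_field_sub_init_le (hΦ : IsSolutionMap v Φ) (hv : IsTimeLipschitzField v a b) (x : V)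
    {t : ℝ} (ht : t ∈ Icc (0 : ℝ) 1) : ‖v t (Φ t x) - v 0 x‖ ≤ b + a * (a + b) :=
  calc ‖v t (Φ t x) - v 0 x‖
    _ ≤ ‖v t (Φ t x) - v 0 (Φ t x)‖ + ‖v 0 (Φ t x) - v 0 x‖ :=
        norm_sub_le_norm_sub_add_norm_sub _ _ _
    _ ≤ b + a * (a + b) := add_le_add (hv.norm_sub_init_le ht _) <|
        (hv.lipschitz_init.norm_sub_le _ _).trans
          (mul_le_mul_of_nonneg_left (hΦ.norm_sub_le hv x ht) a.2)

lemma norm_displacement_sub_le [CompleteSpace V] (hΦ : IsSolutionMap v Φ)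
    (hv : IsTimeLipschitzField v a b) (x : V) : ‖Φ 1 x - x - v 0 x‖ ≤ b + a * (a + b) := by
  have hdispl : Φ 1 x - x - v 0 x = ∫ s in (0 : ℝ)..1, (clampField v (s, Φ s x) - v 0 x) := by
    rw [intervalIntegral.integral_sub ((hΦ.continuous_rhs hv x).intervalIntegrable _ _)
      intervalIntegrable_const, hΦ.eq_add_integral x 1 (by simp)]
    simp
  rw [hdispl]
  refine (intervalIntegral.norm_integral_le_of_norm_le_const (C := b + a * (a + b))
    fun s hs => ?_).trans (by simp)
  rw [uIoc_of_le zero_le_one] at hs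
  have hs' : s ∈ Icc (0 : ℝ) 1 := Ioc_subset_Icc_self hs
  rw [clampField_of_mem v hs']
  exact hΦ.norm_field_sub_init_le hv x hs'

lemma isFlow {d : ℕ} {v Φ : ℝ → Eucl d → Eucl d} (hΦ : IsSolutionMap v Φ)
    (hv : IsTimeLipschitzField v a b) (Ω : Set (Eucl d)) (μ : Measure (Eucl d)) :
    IsFlow Ω μ v Φ where
  init x _ := hΦ.apply_zero x
  absCont x _ := LipschitzOnWith.absolutelyContinuousOnInterval (K := a + b) <| by
    simpa only [uIcc_of_le zero_le_one] using hΦ.lipschitzOnWith hv x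
  ode := by
    filter_upwards [ae_restrict_mem measurableSet_Icc] with t ht x _
    exact hΦ.hasDerivWithinAt hv x ht
  aemeasurable t _ := (hΦ.measurable t).aemeasurable

end IsSolutionMap

end Flow

section ContinuityEquation

lemma deriv_partial_fst {V : Type*} [NormedAddCommGroup V] [NormedSpace ℝ V] {φ : ℝ × V → ℝ}
    {t : ℝ} {x : V} (hφ : DifferentiableAt ℝ φ (t, x)) :
    deriv (fun s => φ (s, x)) t = fderiv ℝ φ (t, x) (1, 0) :=
  (hφ.hasFDerivAt.comp_hasDerivAt t ((hasDerivAt_id t).prodMk (hasDerivAt_const t x))).deriv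

lemma inner_gradient_partial_snd {H : Type*} [NormedAddCommGroup H] [InnerProductSpace ℝ H]
    [CompleteSpace H] {φ : ℝ × H → ℝ} {t : ℝ} {x : H} (hφ : DifferentiableAt ℝ φ (t, x)) (w : H) :
    inner ℝ (gradient (fun y => φ (t, y)) x) w = fderiv ℝ φ (t, x) (0, w) := by
  have hpartial : HasFDerivAt (fun y => φ (t, y))
      ((fderiv ℝ φ (t, x)).comp (ContinuousLinearMap.inr ℝ ℝ H)) x :=
    hφ.hasFDerivAt.comp x (hasFDerivAt_prodMk_right t x)
  rw [gradient, hpartial.fderiv, InnerProductSpace.toDual_symm_apply]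
  rfl

namespace IsSolutionMap

section Normed

variable {V : Type*} [NormedAddCommGroup V] [NormedSpace ℝ V] [MeasurableSpace V]
  {v Φ : ℝ → V → V} {a b : ℝ≥0} {Ω : Set V} {μ : Measure V} {G : ℝ × V → ℝ}

lemma integral_fderiv_comp_eq_sub [CompleteSpace V] (hΦ : IsSolutionMap v Φ)
    (hv : IsTimeLipschitzField v a b) {φ : ℝ × V → ℝ} (hφ : ContDiff ℝ 1 φ) (x : V) :
    ∫ t in (0 : ℝ)..1, fderiv ℝ φ (t, Φ t x) (1, clampField v (t, Φ t x)) =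
      φ (1, Φ 1 x) - φ (0, Φ 0 x) := by
  have hpath : Continuous fun t => (t, Φ t x) := continuous_id.prodMk (hΦ.continuous x)
  refine intervalIntegral.integral_eq_sub_of_hasDeriv_right_of_le zero_le_one
    (f := fun t => φ (t, Φ t x)) (hφ.continuous.comp hpath).continuousOn (fun t ht => ?_)
    ((((hφ.continuous_fderiv one_ne_zero).comp hpath).clm_apply
      (continuous_const.prodMk (hΦ.continuous_rhs hv x))).intervalIntegrable _ _)
  have ht' : t ∈ Icc (0 : ℝ) 1 := Ioo_subset_Icc_self ht
  have hderiv : HasDerivAt (fun s => Φ s x) (clampField v (t, Φ t x)) t :=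
    clampField_of_mem v ht' _ ▸
      (hΦ.hasDerivWithinAt hv x ht').hasDerivAt (Icc_mem_nhds ht.1 ht.2)
  exact (((hφ.differentiable one_ne_zero).differentiableAt.hasFDerivAt).comp_hasDerivAt t
    ((hasDerivAt_id t).prodMk hderiv)).hasDerivWithinAt

lemma exists_bound_comp [ProperSpace V] (hΦ : IsSolutionMap v Φ) (hv : IsTimeLipschitzField v a b)
    (hΩ : Bornology.IsBounded Ω) (hG : Continuous G) :
    ∃ c, ∀ x ∈ Ω, ∀ t ∈ Icc (0 : ℝ) 1, ‖G (t, Φ t x)‖ ≤ c := by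
  obtain ⟨c, hc⟩ := (isCompact_Icc.prod
    (Metric.isCompact_of_isClosed_isBounded Metric.isClosed_cthickening
      (hΩ.cthickening (δ := (a : ℝ) + b)))).exists_bound_of_continuousOn hG.continuousOn
  refine ⟨c, fun x hx t ht => hc _ ⟨ht, ?_⟩⟩
  refine Metric.mem_cthickening_of_dist_le _ _ _ _ hx ?_
  rw [dist_eq_norm]
  exact hΦ.norm_sub_le hv x ht

lemma integral_map_eq [BorelSpace V] (hΦ : IsSolutionMap v Φ) (hG : Continuous G) (t : ℝ) :
    ∫ x, G (t, x) ∂(μ.map (Φ t)) = ∫ x, G (t, Φ t x) ∂μ :=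
  integral_map (hΦ.measurable t).aemeasurable
    (hG.comp (continuous_const.prodMk continuous_id)).aestronglyMeasurable

variable [ProperSpace V] [BorelSpace V]

lemma integrable_comp_prod [IsFiniteMeasure μ] (hΦ : IsSolutionMap v Φ)
    (hv : IsTimeLipschitzField v a b) (hΩ : Bornology.IsBounded Ω) (hμ : ∀ᵐ x ∂μ, x ∈ Ω)
    (hG : Continuous G) :
    Integrable (fun p : ℝ × V => G (p.1, Φ p.1 p.2)) ((volume.restrict (Ioc 0 1)).prod μ) := by
  obtain ⟨c, hc⟩ := hΦ.exists_bound_comp hv hΩ hG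
  refine Integrable.of_bound (hG.measurable.comp
    (measurable_fst.prodMk hΦ.measurable_uncurry)).aestronglyMeasurable c ?_
  filter_upwards [Measure.quasiMeasurePreserving_fst.ae (ae_restrict_mem measurableSet_Ioc),
    Measure.quasiMeasurePreserving_snd.ae hμ] with p hp₁ hp₂
  exact hc _ hp₂ _ (Ioc_subset_Icc_self hp₁)

lemma integrable_comp [IsFiniteMeasure μ] (hΦ : IsSolutionMap v Φ)
    (hv : IsTimeLipschitzField v a b) (hΩ : Bornology.IsBounded Ω) (hμ : ∀ᵐ x ∂μ, x ∈ Ω)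
    (hG : Continuous G) {t : ℝ} (ht : t ∈ Icc (0 : ℝ) 1) :
    Integrable (fun x => G (t, Φ t x)) μ := by
  obtain ⟨c, hc⟩ := hΦ.exists_bound_comp hv hΩ hG
  refine Integrable.of_bound (hG.measurable.comp
    (measurable_const.prodMk (hΦ.measurable t))).aestronglyMeasurable c ?_
  filter_upwards [hμ] with x hx using hc x hx t ht

lemma integrable_integral_comp [IsFiniteMeasure μ] (hΦ : IsSolutionMap v Φ)
    (hv : IsTimeLipschitzField v a b) (hΩ : Bornology.IsBounded Ω) (hμ : ∀ᵐ x ∂μ, x ∈ Ω)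
    (hG : Continuous G) : Integrable (fun x => ∫ t in (0 : ℝ)..1, G (t, Φ t x)) μ := by
  simpa only [intervalIntegral.integral_of_le zero_le_one] using
    (hΦ.integrable_comp_prod hv hΩ hμ hG).integral_prod_right

lemma integral_integral_map_eq [IsFiniteMeasure μ] (hΦ : IsSolutionMap v Φ)
    (hv : IsTimeLipschitzField v a b) (hΩ : Bornology.IsBounded Ω) (hμ : ∀ᵐ x ∂μ, x ∈ Ω)
    (hG : Continuous G) :
    ∫ t in (0 : ℝ)..1, ∫ x, G (t, x) ∂(μ.map (Φ t)) =
      ∫ x, (∫ t in (0 : ℝ)..1, G (t, Φ t x)) ∂μ := by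
  simp only [intervalIntegral.integral_of_le zero_le_one, hΦ.integral_map_eq hG]
  exact integral_integral_swap (f := fun t x => G (t, Φ t x)) (hΦ.integrable_comp_prod hv hΩ hμ hG)

end Normed

lemma isContinuityEq_map {d : ℕ} {v Φ : ℝ → Eucl d → Eucl d} {a b : ℝ≥0} {Ω : Set (Eucl d)}
    {μ : Measure (Eucl d)} [IsFiniteMeasure μ] (hΦ : IsSolutionMap v Φ)
    (hv : IsTimeLipschitzField v a b) (hΩ : Bornology.IsBounded Ω) (hμ : ∀ᵐ x ∂μ, x ∈ Ω) :
    IsContinuityEq (fun t => μ.map (Φ t)) (fun t x => clampField v (t, x)) where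
  measurable := hv.continuous_clampField.measurable
  memLp t _ := MemLp.of_bound (hv.continuous_clampField.comp
    (continuous_const.prodMk continuous_id)).aestronglyMeasurable _
    (.of_forall fun x => hv.norm_clampField_le _)
  eq φ hφ := by
    have hφ' := hφ.continuous_fderiv one_ne_zero
    have hG₁ : Continuous fun q => fderiv ℝ φ q (1, 0) := hφ'.clm_apply continuous_const
    have hG₂ : Continuous fun q => fderiv ℝ φ q (0, clampField v q) :=
      hφ'.clm_apply (continuous_const.prodMk hv.continuous_clampField)
    have hdiff := hφ.differentiable one_ne_zero
    simp only [deriv_partial_fst (hdiff _), inner_gradient_partial_snd (hdiff _)]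
    rw [hΦ.integral_integral_map_eq hv hΩ hμ hG₁, hΦ.integral_integral_map_eq hv hΩ hμ hG₂,
      hΦ.integral_map_eq hφ.continuous, hΦ.integral_map_eq hφ.continuous,
      ← integral_add (hΦ.integrable_integral_comp hv hΩ hμ hG₁)
        (hΦ.integrable_integral_comp hv hΩ hμ hG₂),
      ← integral_sub (hΦ.integrable_comp hv hΩ hμ hφ.continuous (by simp))
        (hΦ.integrable_comp hv hΩ hμ hφ.continuous (by simp))]
    congr with x
    have hpath : Continuous fun t => (t, Φ t x) := continuous_id.prodMk (hΦ.continuous x)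
    have hpath₁ : Continuous fun t => fderiv ℝ φ (t, Φ t x) (1, 0) := hG₁.comp hpath
    have hpath₂ : Continuous fun t => fderiv ℝ φ (t, Φ t x) (0, clampField v (t, Φ t x)) :=
      hG₂.comp hpath
    rw [← hΦ.integral_fderiv_comp_eq_sub hv hφ x, ← intervalIntegral.integral_add
      (hpath₁.intervalIntegrable _ _) (hpath₂.intervalIntegrable _ _)]
    simp [← map_add]

end IsSolutionMap

end ContinuityEquation

section Coupling

variable {d : ℕ} {μ ν : Measure (Eucl d)} {r : ℝ≥0∞}

lemma ennreal_sq_rpow_half (x : ℝ≥0∞) : (x ^ 2) ^ (1 / 2 : ℝ) = x := by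
  rw [← ENNReal.rpow_natCast, ← ENNReal.rpow_mul]
  norm_num

lemma wassEDist_le_of_coupling (κ : Measure (Eucl d × Eucl d)) [IsProbabilityMeasure κ]
    (h₁ : κ.map Prod.fst = μ) (h₂ : κ.map Prod.snd = ν) (hr : ∀ᵐ p ∂κ, edist p.1 p.2 ≤ r) :
    wassEDist μ ν ≤ r := by
  have hcost : ∫⁻ p, ‖p.1 - p.2‖ₑ ^ 2 ∂κ ≤ r ^ 2 :=
    calc ∫⁻ p, ‖p.1 - p.2‖ₑ ^ 2 ∂κ ≤ ∫⁻ _, r ^ 2 ∂κ := by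
          refine lintegral_mono_ae (hr.mono fun p hp => ?_)
          rw [← edist_eq_enorm_sub]
          gcongr
      _ = r ^ 2 := by simp
  calc wassEDist μ ν ≤ (r ^ 2) ^ (1 / 2 : ℝ) :=
        ENNReal.rpow_le_rpow ((iInf₂_le_of_le κ h₁ (iInf_le _ h₂)).trans hcost) (by norm_num)
    _ = r := ennreal_sq_rpow_half r

lemma wassEDist_le_ediam [IsProbabilityMeasure μ] [IsProbabilityMeasure ν] {Ω : Set (Eucl d)}
    (hμ : ∀ᵐ x ∂μ, x ∈ Ω) (hν : ∀ᵐ x ∂ν, x ∈ Ω) : wassEDist μ ν ≤ Metric.ediam Ω := by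
  refine wassEDist_le_of_coupling (μ.prod ν) (by simp [Measure.map_fst_prod])
    (by simp [Measure.map_snd_prod]) ?_
  filter_upwards [Measure.quasiMeasurePreserving_fst.ae hμ,
    Measure.quasiMeasurePreserving_snd.ae hν] with p hp₁ hp₂
  exact Metric.edist_le_ediam_of_mem hp₁ hp₂

lemma wassEDist_map_le [IsProbabilityMeasure μ] {S T : Eucl d → Eucl d} (hS : Measurable S)
    (hT : Measurable T) (hr : ∀ᵐ x ∂μ, edist (S x) (T x) ≤ r) :
    wassEDist (μ.map S) (μ.map T) ≤ r := by
  have hST : Measurable fun x => (S x, T x) := hS.prodMk hT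
  have : IsProbabilityMeasure (μ.map fun x => (S x, T x)) :=
    Measure.isProbabilityMeasure_map hST.aemeasurable
  refine wassEDist_le_of_coupling (μ.map fun x => (S x, T x)) ?_ ?_ ?_
  · rw [Measure.map_map measurable_fst hST]; rfl
  · rw [Measure.map_map measurable_snd hST]; rfl
  · rwa [ae_map_iff hST.aemeasurable (measurableSet_le (by fun_prop) measurable_const)]

end Coupling

section LpNorm

variable {α V : Type*} [MeasurableSpace α] [NormedAddCommGroup V] {μ : Measure α} {f g : α → V}

lemma lintegral_enorm_sq_eq_eLpNorm_sq : ∫⁻ x, ‖f x‖ₑ ^ 2 ∂μ = eLpNorm f 2 μ ^ 2 := by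
  simpa using (eLpNorm_nnreal_pow_eq_lintegral (f := f) (μ := μ) (p := 2) two_ne_zero).symm

lemma integral_norm_sq_eq_lpNorm_sq (hf : MemLp f 2 μ) :
    ∫ x, ‖f x‖ ^ 2 ∂μ = lpNorm f 2 μ ^ 2 := by
  rw [lpNorm_eq_integral_norm_rpow_toReal two_ne_zero (by norm_num) hf.1]
  simp only [ENNReal.toReal_ofNat, Real.rpow_two]
  rw [← Real.rpow_natCast, ← Real.rpow_mul (integral_nonneg fun x => by positivity)]
  norm_num

lemma ofReal_integral_norm_sq_eq_lintegral (hf : MemLp f 2 μ) :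
    ENNReal.ofReal (∫ x, ‖f x‖ ^ 2 ∂μ) = ∫⁻ x, ‖f x‖ₑ ^ 2 ∂μ := by
  rw [ofReal_integral_eq_lintegral_ofReal (hf.integrable_norm_pow two_ne_zero)
    (.of_forall fun x => by positivity)]
  simp only [ENNReal.ofReal_pow (norm_nonneg _), ofReal_norm]

lemma lpNorm_le_lpNorm_add_of_norm_sub_le [IsProbabilityMeasure μ] {p : ℝ≥0∞} (hp : 1 ≤ p)
    (hf : MemLp f p μ) (hg : MemLp g p μ) {c : ℝ} (h : ∀ᵐ x ∂μ, ‖f x - g x‖ ≤ c) :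
    lpNorm f p μ ≤ lpNorm g p μ + c := by
  obtain ⟨x, hx⟩ := h.exists
  have hc : 0 ≤ c := (norm_nonneg _).trans hx
  have hsub : lpNorm (f - g) p μ ≤ c := by
    rw [← toReal_eLpNorm (hf.sub hg).1]
    refine ENNReal.toReal_le_of_le_ofReal hc ((eLpNorm_le_of_ae_bound h).trans_eq ?_)
    simp
  linarith [lpNorm_le_lpNorm_add_lpNorm_sub' hg hp (f := f)]

end LpNorm

section Kantorovich

variable {d : ℕ} {μ ν : Measure (Eucl d)} {f : Eucl d → ℝ} {ℓ : ℝ≥0}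

lemma edist_integral_le_of_coupling [IsProbabilityMeasure μ] (hf : LipschitzWith ℓ f)
    (hμ : Integrable f μ) (hν : Integrable f ν) {κ : Measure (Eucl d × Eucl d)}
    (h₁ : κ.map Prod.fst = μ) (h₂ : κ.map Prod.snd = ν) :
    edist (∫ x, f x ∂μ) (∫ x, f x ∂ν) ≤ ℓ * (∫⁻ p, ‖p.1 - p.2‖ₑ ^ 2 ∂κ) ^ (1 / 2 : ℝ) := by
  subst h₁ h₂
  have : IsProbabilityMeasure κ := Measure.isProbabilityMeasure_of_map (f := Prod.fst)
  have hfm : Measurable f := hf.continuous.measurable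
  have hμ' : Integrable (fun p => f p.1) κ := hμ.comp_measurable measurable_fst
  have hν' : Integrable (fun p => f p.2) κ := hν.comp_measurable measurable_snd
  rw [integral_map measurable_fst.aemeasurable hfm.aestronglyMeasurable,
    integral_map measurable_snd.aemeasurable hfm.aestronglyMeasurable, edist_eq_enorm_sub,
    ← integral_sub hμ' hν']
  calc ‖∫ p, (f p.1 - f p.2) ∂κ‖ₑ
    _ ≤ ∫⁻ p, ‖f p.1 - f p.2‖ₑ ∂κ := enorm_integral_le_lintegral_enorm _
    _ ≤ ∫⁻ p, ℓ * ‖p.1 - p.2‖ₑ ∂κ := lintegral_mono fun p => by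
        simpa only [edist_eq_enorm_sub] using hf p.1 p.2
    _ = ℓ * eLpNorm (fun p : Eucl d × Eucl d => p.1 - p.2) 1 κ := by
        rw [lintegral_const_mul _ (by fun_prop), eLpNorm_one_eq_lintegral_enorm]
    _ ≤ ℓ * eLpNorm (fun p : Eucl d × Eucl d => p.1 - p.2) 2 κ := by
        gcongr
        exact eLpNorm_le_eLpNorm_of_exponent_le (by norm_num)
          (Measurable.aestronglyMeasurable (by fun_prop))
    _ = ℓ * (∫⁻ p, ‖p.1 - p.2‖ₑ ^ 2 ∂κ) ^ (1 / 2 : ℝ) := by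
        rw [lintegral_enorm_sq_eq_eLpNorm_sq, ennreal_sq_rpow_half]

lemma edist_integral_le_wassEDist [IsProbabilityMeasure μ] (hℓ : ℓ ≠ 0) (hf : LipschitzWith ℓ f)
    (hμ : Integrable f μ) (hν : Integrable f ν) :
    edist (∫ x, f x ∂μ) (∫ x, f x ∂ν) ≤ ℓ * wassEDist μ ν := by
  have hdiv {b : ℝ≥0∞} : edist (∫ x, f x ∂μ) (∫ x, f x ∂ν) ≤ ℓ * b ^ (1 / 2 : ℝ) ↔
      (edist (∫ x, f x ∂μ) (∫ x, f x ∂ν) / ℓ) ^ (2 : ℝ) ≤ b := by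
    rw [mul_comm, ← ENNReal.div_le_iff (by simpa using hℓ) ENNReal.coe_ne_top,
      ← ENNReal.rpow_le_rpow_iff (z := 2) (by norm_num), ← ENNReal.rpow_mul]
    norm_num
  rw [wassEDist, hdiv]
  exact le_iInf fun κ => le_iInf₂ fun h₁ h₂ =>
    hdiv.1 (edist_integral_le_of_coupling hf hμ hν h₁ h₂)

end Kantorovich

section Duality

lemma ofReal_integral_le_lintegral_ofReal {α : Type*} [MeasurableSpace α] {μ : Measure α}
    {f : α → ℝ} (hf : Integrable f μ) :
    ENNReal.ofReal (∫ x, f x ∂μ) ≤ ∫⁻ x, ENNReal.ofReal (f x) ∂μ :=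
  calc ENNReal.ofReal (∫ x, f x ∂μ)
    _ ≤ ENNReal.ofReal (∫ x, max (f x) 0 ∂μ) :=
        ENNReal.ofReal_le_ofReal (integral_mono hf hf.pos_part fun x => le_max_left _ _)
    _ = ∫⁻ x, ENNReal.ofReal (max (f x) 0) ∂μ :=
        ofReal_integral_eq_lintegral_ofReal hf.pos_part (.of_forall fun x => le_max_right _ _)
    _ = ∫⁻ x, ENNReal.ofReal (f x) ∂μ := by simp

/-- `φ` is a subsolution of the Hamilton–Jacobi equation `∂ₜφ + ½|∇φ|² = 0` on the time interval
`[0,1]`. -/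
def IsHamiltonJacobiSubsolution {H : Type*} [NormedAddCommGroup H] [InnerProductSpace ℝ H]
    [CompleteSpace H] (φ : ℝ × H → ℝ) : Prop :=
  ∀ t ∈ Icc (0 : ℝ) 1, ∀ x,
    deriv (fun s => φ (s, x)) t + 1 / 2 * ‖gradient (fun y => φ (t, y)) x‖ ^ 2 ≤ 0

variable {H : Type*} [NormedAddCommGroup H] [InnerProductSpace ℝ H] [CompleteSpace H]
  {φ : ℝ × H → ℝ}

namespace IsHamiltonJacobiSubsolution

lemma deriv_nonpos (hφ : IsHamiltonJacobiSubsolution φ) {t : ℝ} (ht : t ∈ Icc (0 : ℝ) 1) (x : H) :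
    deriv (fun s => φ (s, x)) t ≤ 0 := by
  nlinarith [hφ t ht x, sq_nonneg ‖gradient (fun y => φ (t, y)) x‖]

lemma inner_gradient_le (hφ : IsHamiltonJacobiSubsolution φ) {t : ℝ} (ht : t ∈ Icc (0 : ℝ) 1)
    (x w : H) : inner ℝ (gradient (fun y => φ (t, y)) x) w ≤
      1 / 2 * ‖w‖ ^ 2 - deriv (fun s => φ (s, x)) t := by
  nlinarith [hφ t ht x, real_inner_le_norm (gradient (fun y => φ (t, y)) x) w,
    sq_nonneg (‖gradient (fun y => φ (t, y)) x‖ - ‖w‖)]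

lemma two_mul_integral_deriv_add_le [MeasurableSpace H] (hφ : IsHamiltonJacobiSubsolution φ) {t : ℝ}
    (ht : t ∈ Icc (0 : ℝ) 1) {μ : Measure H}
    (hint : Integrable (fun x => deriv (fun s => φ (s, x)) t) μ) {w : H → H} (hw : MemLp w 2 μ) :
    2 * ((∫ x, deriv (fun s => φ (s, x)) t ∂μ) +
      ∫ x, inner ℝ (gradient (fun y => φ (t, y)) x) (w x) ∂μ) ≤ ∫ x, ‖w x‖ ^ 2 ∂μ := by
  have hw2 : Integrable (fun x => ‖w x‖ ^ 2) μ := hw.integrable_norm_pow two_ne_zero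
  by_cases hi : Integrable (fun x => inner ℝ (gradient (fun y => φ (t, y)) x) (w x)) μ
  · have hmono := integral_mono hi ((hw2.const_mul _).sub hint)
      fun x => hφ.inner_gradient_le ht x (w x)
    simp only [Pi.sub_apply] at hmono
    rw [integral_sub (hw2.const_mul _) hint, integral_const_mul] at hmono
    linarith
  · rw [integral_undef hi]
    have hnonpos : ∫ x, deriv (fun s => φ (s, x)) t ∂μ ≤ 0 :=
      integral_nonpos fun x => hφ.deriv_nonpos ht x
    have hnonneg : 0 ≤ ∫ x, ‖w x‖ ^ 2 ∂μ := integral_nonneg fun x => by positivity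
    linarith

end IsHamiltonJacobiSubsolution

lemma IsContinuityEq.ofReal_le_lintegral {d : ℕ} {ρ : ℝ → Measure (Eucl d)}
    {v : ℝ → Eucl d → Eucl d} (hv : IsContinuityEq ρ v) {φ : ℝ × Eucl d → ℝ} (hφ : ContDiff ℝ 1 φ)
    (hsub : IsHamiltonJacobiSubsolution φ)
    (hint : ∀ t ∈ Icc (0 : ℝ) 1, Integrable (fun x => deriv (fun s => φ (s, x)) t) (ρ t))
    (hint' : IntervalIntegrable (fun t => ∫ x, deriv (fun s => φ (s, x)) t ∂ρ t) volume 0 1) :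
    ENNReal.ofReal (2 * ((∫ x, φ (1, x) ∂ρ 1) - ∫ x, φ (0, x) ∂ρ 0)) ≤
      ∫⁻ t in Icc (0 : ℝ) 1, ∫⁻ x, ‖v t x‖ₑ ^ 2 ∂ρ t := by
  rw [← hv.eq φ hφ]
  let g t := ∫ x, deriv (fun s => φ (s, x)) t ∂ρ t
  let h t := ∫ x, inner ℝ (gradient (fun y => φ (t, y)) x) (v t x) ∂ρ t
  change ENNReal.ofReal (2 * ((∫ t in (0 : ℝ)..1, g t) + ∫ t in (0 : ℝ)..1, h t)) ≤ _
  by_cases hh : IntervalIntegrable h volume 0 1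
  · rw [← intervalIntegral.integral_add hint' hh, ← intervalIntegral.integral_const_mul,
      intervalIntegral.integral_of_le zero_le_one, ← integral_Icc_eq_integral_Ioc]
    have hI : IntegrableOn (fun t => 2 * (g t + h t)) (Icc 0 1) := by
      rw [← intervalIntegrable_iff_integrableOn_Icc_of_le zero_le_one]
      exact (hint'.add hh).const_mul 2
    refine (ofReal_integral_le_lintegral_ofReal hI).trans (lintegral_mono_ae ?_)
    filter_upwards [ae_restrict_mem measurableSet_Icc] with t ht
    rw [← ofReal_integral_norm_sq_eq_lintegral (hv.memLp t ht)]
    exact ENNReal.ofReal_le_ofReal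
      (hsub.two_mul_integral_deriv_add_le ht (hint t ht) (hv.memLp t ht))
  · have hg : ∫ t in (0 : ℝ)..1, g t ≤ 0 :=
      intervalIntegral.integral_of_le (μ := volume) (f := g) zero_le_one ▸
        setIntegral_nonpos measurableSet_Ioc fun t ht =>
          integral_nonpos fun x => hsub.deriv_nonpos (Ioc_subset_Icc_self ht) x
    rw [intervalIntegral.integral_undef hh, ENNReal.ofReal_of_nonpos (by linarith)]
    exact zero_le

end Duality

section HamiltonJacobi

lemma contDiff_one_of_hasGradientAt {H : Type*} [NormedAddCommGroup H] [InnerProductSpace ℝ H]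
    [CompleteSpace H] {ψ : H → ℝ} {p : H → H} (hψ : ∀ x, HasGradientAt ψ (p x) x)
    (hp : Continuous p) : ContDiff ℝ 1 ψ := by
  rw [contDiff_one_iff_fderiv]
  refine ⟨fun x => (hψ x).hasFDerivAt.differentiableAt, ?_⟩
  rw [show fderiv ℝ ψ = fun x => InnerProductSpace.toDual ℝ H (p x) from
    funext fun x => (hψ x).hasFDerivAt.fderiv]
  exact (InnerProductSpace.toDual ℝ H).continuous.comp hp

lemma lipschitzWith_norm_sq {X E : Type*} [PseudoMetricSpace X] [SeminormedAddCommGroup E]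
    {p : X → E} {A L : ℝ≥0} (hp : LipschitzWith L p) (hA : ∀ x, ‖p x‖ ≤ A) :
    LipschitzWith (2 * A * L) fun x => ‖p x‖ ^ 2 := by
  refine LipschitzWith.of_dist_le_mul fun x y => ?_
  calc dist (‖p x‖ ^ 2) (‖p y‖ ^ 2)
    _ = (‖p x‖ + ‖p y‖) * |‖p x‖ - ‖p y‖| := by
        rw [Real.dist_eq, ← abs_of_nonneg (add_nonneg (norm_nonneg (p x)) (norm_nonneg (p y))),
          ← abs_mul]
        congr 1
        ring
    _ ≤ (A + A) * (L * dist x y) := by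
        gcongr
        · exact hA x
        · exact hA y
        · exact (abs_norm_sub_norm_le _ _).trans (dist_eq_norm (p x) (p y) ▸ hp.dist_le_mul x y)
    _ = ↑(2 * A * L) * dist x y := by push_cast; ring

section Potential

variable {H : Type*} [NormedAddCommGroup H]

/-- The potential `ψ + (κ/2)(1 - t)|p|²`. For `p = ∇ψ` with small derivative, a value of `κ`
slightly above `1` makes it a subsolution of the Hamilton–Jacobi equation with final value `ψ`. -/
def hamiltonJacobiPotential (ψ : H → ℝ) (p : H → H) (κ : ℝ) (q : ℝ × H) : ℝ :=
  ψ q.2 + κ / 2 * (1 - q.1) * ‖p q.2‖ ^ 2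

lemma deriv_hamiltonJacobiPotential (ψ : H → ℝ) (p : H → H) (κ t : ℝ) (x : H) :
    deriv (fun s => hamiltonJacobiPotential ψ p κ (s, x)) t = -(κ / 2) * ‖p x‖ ^ 2 := by
  have hderiv : HasDerivAt (fun s => hamiltonJacobiPotential ψ p κ (s, x))
      (κ / 2 * (-1) * ‖p x‖ ^ 2) t :=
    ((((hasDerivAt_id t).const_sub 1).const_mul (κ / 2)).mul_const (‖p x‖ ^ 2)).const_add (ψ x)
  rw [hderiv.deriv]
  ring

variable [InnerProductSpace ℝ H] [CompleteSpace H] {ψ : H → ℝ} {p : H → H}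

lemma contDiff_hamiltonJacobiPotential (hψ : ∀ x, HasGradientAt ψ (p x) x) (hp : ContDiff ℝ 1 p)
    (κ : ℝ) : ContDiff ℝ 1 (hamiltonJacobiPotential ψ p κ) :=
  ((contDiff_one_of_hasGradientAt hψ hp.continuous).comp contDiff_snd).add
    ((contDiff_const.mul (contDiff_const.sub contDiff_fst)).mul ((hp.comp contDiff_snd).norm_sq ℝ))

lemma norm_gradient_hamiltonJacobiPotential_le (hψ : ∀ x, HasGradientAt ψ (p x) x)
    (hp : Differentiable ℝ p) {L : ℝ≥0} (hL : LipschitzWith L p) {κ t : ℝ} (hκ : 0 ≤ κ)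
    (ht : t ∈ Icc (0 : ℝ) 1) (x : H) :
    ‖gradient (fun y => hamiltonJacobiPotential ψ p κ (t, y)) x‖ ≤ (1 + κ * L) * ‖p x‖ := by
  have hsq : HasFDerivAt (fun y => κ / 2 * (1 - t) * ‖p y‖ ^ 2)
      ((κ / 2 * (1 - t)) • (2 • (innerSL ℝ (p x)).comp (fderiv ℝ p x))) x :=
    (hp x).hasFDerivAt.norm_sq.const_mul _
  have hderiv := (hψ x).hasFDerivAt.add hsq
  change HasFDerivAt (fun y => hamiltonJacobiPotential ψ p κ (t, y)) _ x at hderiv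
  have hcomp : ‖(innerSL ℝ (p x)).comp (fderiv ℝ p x)‖ ≤ ‖p x‖ * L := by
    refine (ContinuousLinearMap.opNorm_comp_le _ _).trans ?_
    rw [innerSL_apply_norm]
    gcongr
    exact norm_fderiv_le_of_lipschitz ℝ hL
  rw [gradient, hderiv.fderiv, LinearIsometryEquiv.norm_map]
  calc _ ≤ ‖p x‖ + κ * (1 - t) * ‖(innerSL ℝ (p x)).comp (fderiv ℝ p x)‖ := by
        refine (norm_add_le _ _).trans_eq ?_
        rw [LinearIsometryEquiv.norm_map, norm_smul, two_nsmul, ← two_smul ℝ, norm_smul,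
          Real.norm_of_nonneg (mul_nonneg (by positivity) (sub_nonneg.2 ht.2)), Real.norm_ofNat]
        ring
    _ ≤ ‖p x‖ + κ * 1 * (‖p x‖ * L) := by
        gcongr
        linarith [ht.1]
    _ = (1 + κ * L) * ‖p x‖ := by ring

lemma isHamiltonJacobiSubsolution_hamiltonJacobiPotential (hψ : ∀ x, HasGradientAt ψ (p x) x)
    (hp : Differentiable ℝ p) {L : ℝ≥0} (hL : LipschitzWith L p) (hL8 : L ≤ 1 / 8) :
    IsHamiltonJacobiSubsolution (hamiltonJacobiPotential ψ p (1 + 8 * L)) := by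
  intro t ht x
  have hL8' : (L : ℝ) ≤ 1 / 8 := by exact_mod_cast hL8
  have hκ : (1 + (1 + 8 * (L : ℝ)) * L) ^ 2 ≤ 1 + 8 * L :=
    calc (1 + (1 + 8 * (L : ℝ)) * L) ^ 2
      _ ≤ (1 + 2 * L) ^ 2 := by gcongr; linarith
      _ ≤ 1 + 8 * L := by nlinarith [mul_le_mul_of_nonneg_left hL8' L.coe_nonneg]
  rw [deriv_hamiltonJacobiPotential]
  have hgrad := pow_le_pow_left₀ (norm_nonneg _)
    (norm_gradient_hamiltonJacobiPotential_le hψ hp hL (κ := 1 + 8 * L) (by positivity) ht x) 2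
  rw [mul_pow] at hgrad
  linarith [mul_le_mul_of_nonneg_right hκ (sq_nonneg ‖p x‖)]

end Potential

section Energy

variable {d : ℕ} {ρ : ℝ → Measure (Eucl d)} {k : ℝ≥0} {f : Eucl d → ℝ}

lemma continuousOn_integral_of_lipschitzWith (hρ : ∀ t ∈ Icc (0 : ℝ) 1, IsProbabilityMeasure (ρ t))
    (hlip : ∀ s ∈ Icc (0 : ℝ) 1, ∀ t ∈ Icc (0 : ℝ) 1, wassEDist (ρ s) (ρ t) ≤ k * edist s t)
    {ℓ : ℝ≥0} (hf : LipschitzWith ℓ f) (hint : ∀ t ∈ Icc (0 : ℝ) 1, Integrable f (ρ t)) :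
    ContinuousOn (fun t => ∫ x, f x ∂ρ t) (Icc 0 1) := by
  have hlip' : LipschitzOnWith ((ℓ + 1) * k) (fun t => ∫ x, f x ∂ρ t) (Icc 0 1) := by
    intro s hs t ht
    have := hρ s hs
    have hf' : LipschitzWith (ℓ + 1) f := hf.weaken (le_add_of_nonneg_right zero_le_one)
    refine (edist_integral_le_wassEDist (by positivity) hf' (hint s hs) (hint t ht)).trans ?_
    rw [ENNReal.coe_mul, mul_assoc]
    gcongr
    exact hlip s hs t ht
  exact hlip'.continuousOn

lemma ofReal_sub_integral_norm_sq_le_energy {ψ : Eucl d → ℝ} {p : Eucl d → Eucl d}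
    (hψ : ∀ x, HasGradientAt ψ (p x) x) (hp : ContDiff ℝ 1 p) {A L : ℝ≥0} (hA : ∀ x, ‖p x‖ ≤ A)
    (hL : LipschitzWith L p) (hL8 : L ≤ 1 / 8)
    (hρ : ∀ t ∈ Icc (0 : ℝ) 1, IsProbabilityMeasure (ρ t))
    (hlip : ∀ s ∈ Icc (0 : ℝ) 1, ∀ t ∈ Icc (0 : ℝ) 1, wassEDist (ρ s) (ρ t) ≤ k * edist s t)
    (hψ₀ : Integrable ψ (ρ 0)) :
    ENNReal.ofReal (2 * ((∫ x, ψ x ∂ρ 1) - ∫ x, ψ x ∂ρ 0) -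
      (1 + 8 * L) * ∫ x, ‖p x‖ ^ 2 ∂ρ 0) ≤ energy ρ := by
  refine le_iInf₂ fun v hv => ?_
  set φ := hamiltonJacobiPotential ψ p (1 + 8 * L) with hφ
  have hp2 (t) (ht : t ∈ Icc (0 : ℝ) 1) : Integrable (fun x => ‖p x‖ ^ 2) (ρ t) := by
    have := hρ t ht
    exact (MemLp.of_bound hp.continuous.aestronglyMeasurable A
      (.of_forall hA)).integrable_norm_pow two_ne_zero
  have hcont := continuousOn_integral_of_lipschitzWith hρ hlip (lipschitzWith_norm_sq hL hA) hp2
  have hφ₁ : ∫ x, φ (1, x) ∂ρ 1 = ∫ x, ψ x ∂ρ 1 := by simp [hφ, hamiltonJacobiPotential]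
  have hφ₀ : ∫ x, φ (0, x) ∂ρ 0 = ∫ x, ψ x ∂ρ 0 + (1 + 8 * L) / 2 * ∫ x, ‖p x‖ ^ 2 ∂ρ 0 := by
    simp only [hφ, hamiltonJacobiPotential, sub_zero, mul_one]
    rw [integral_add hψ₀ ((hp2 0 (by simp)).const_mul _), integral_const_mul]
  have hdual := hv.ofReal_le_lintegral (contDiff_hamiltonJacobiPotential hψ hp _)
    (isHamiltonJacobiSubsolution_hamiltonJacobiPotential hψ (hp.differentiable one_ne_zero) hL hL8)
    (fun t ht => by simpa only [deriv_hamiltonJacobiPotential] using (hp2 t ht).const_mul _)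
    (by
      simp only [deriv_hamiltonJacobiPotential, integral_const_mul]
      exact (ContinuousOn.intervalIntegrable (by rwa [uIcc_of_le zero_le_one])).const_mul _)
  rw [← hφ, hφ₁, hφ₀] at hdual
  refine (ENNReal.ofReal_le_ofReal (le_of_eq ?_)).trans hdual
  ring

end Energy

end HamiltonJacobi

section Transport

/-- `T` transports `μ` to `ν` and, up to an error `ε`, moves the points by the displacement `p`; no
point is moved by more than `r`. -/
structure IsApproxTransport {V : Type*} [NormedAddCommGroup V] [MeasurableSpace V]
    (μ ν : Measure V) (p T : V → V) (r ε : ℝ≥0) : Prop where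
  measurable : Measurable T
  map_eq : μ.map T = ν
  norm_sub_le : ∀ᵐ x ∂μ, ‖T x - x‖ ≤ r
  norm_sub_sub_le : ∀ᵐ x ∂μ, ‖T x - x - p x‖ ≤ ε

lemma integrable_of_continuous_of_isCompact {X E : Type*} [TopologicalSpace X]
    [T2Space X] [MeasurableSpace X] [BorelSpace X] [NormedAddCommGroup E] {Ω : Set X}
    (hΩ : IsCompact Ω) {μ : Measure X} [IsFiniteMeasure μ] (hμ : ∀ᵐ x ∂μ, x ∈ Ω) {f : X → E}
    (hf : Continuous f) : Integrable f μ := by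
  rw [← Measure.restrict_eq_self_of_ae_mem hμ]
  exact hf.continuousOn.integrableOn_compact hΩ

lemma abs_sub_sub_inner_le_of_hasGradientAt {H : Type*} [NormedAddCommGroup H]
    [InnerProductSpace ℝ H] [CompleteSpace H] {ψ : H → ℝ} {p : H → H}
    (hψ : ∀ x, HasGradientAt ψ (p x) x) {L : ℝ≥0} (hp : LipschitzWith L p) {r : ℝ} {x y z : H}
    (hx : ‖x - z‖ ≤ r) (hy : ‖y - z‖ ≤ r) :
    |ψ y - ψ x - inner ℝ (p z) (y - x)| ≤ L * r * ‖y - x‖ := by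
  have hderiv (u : H) : HasFDerivAt (fun u => ψ u - inner ℝ (p z) u)
      (InnerProductSpace.toDual ℝ H (p u - p z)) u := by
    rw [map_sub]
    exact (hψ u).hasFDerivAt.sub (InnerProductSpace.toDual ℝ H (p z)).hasFDerivAt
  have hmean := (convex_closedBall z r).norm_image_sub_le_of_norm_hasFDerivWithin_le (C := L * r)
    (fun u _ => (hderiv u).hasFDerivWithinAt)
    (fun u hu => by
      rw [LinearIsometryEquiv.norm_map]
      exact (hp.norm_sub_le u z).trans (by gcongr; exact mem_closedBall_iff_norm.1 hu))
    (mem_closedBall_iff_norm.2 hx) (mem_closedBall_iff_norm.2 hy)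
  rw [inner_sub_right]
  convert! hmean using 2
  ring

lemma norm_sq_sub_norm_mul_le_inner {H : Type*} [NormedAddCommGroup H] [InnerProductSpace ℝ H]
    {w y : H} {ε : ℝ} (h : ‖y - w‖ ≤ ε) : ‖w‖ ^ 2 - ‖w‖ * ε ≤ inner ℝ w y := by
  have hinner : inner ℝ w (y - w) = inner ℝ w y - ‖w‖ ^ 2 := by
    rw [inner_sub_right, real_inner_self_eq_norm_sq]
  have hε : |inner ℝ w (y - w)| ≤ ‖w‖ * ε :=
    (abs_real_inner_le_norm _ _).trans (mul_le_mul_of_nonneg_left h (norm_nonneg w))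
  linarith [neg_le_of_abs_le hε]

lemma norm_sq_le_of_hasGradientAt {H : Type*} [NormedAddCommGroup H] [InnerProductSpace ℝ H]
    [CompleteSpace H] {u : H → ℝ} {w : H → H} (hu : ∀ x, HasGradientAt u (w x) x) {ℓ : ℝ≥0}
    (hw : LipschitzWith ℓ w) {r ε : ℝ} {x y z : H} (hy : ‖y - x‖ ≤ r) (hz : ‖z - x‖ ≤ r)
    (h : ‖y - z - w x‖ ≤ ε) : ‖w x‖ ^ 2 ≤ 2 * (u y - u z) + 4 * (ε + ℓ * r) ^ 2 := by
  have hε : 0 ≤ ε := (norm_nonneg _).trans h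
  have hℓr : 0 ≤ ℓ * r := mul_nonneg ℓ.2 ((norm_nonneg _).trans hy)
  have hinner := norm_sq_sub_norm_mul_le_inner h
  have hnorm : ‖y - z‖ ≤ ‖w x‖ + ε := (norm_le_norm_add_norm_sub' _ (w x)).trans (by gcongr)
  have hTaylor := (abs_sub_sub_inner_le_of_hasGradientAt hu hw hz hy).trans
    (mul_le_mul_of_nonneg_left hnorm hℓr)
  nlinarith [neg_le_of_abs_le hTaylor, sq_nonneg (‖w x‖ - (ε + ℓ * r))]

namespace IsApproxTransport

section Normed

variable {V : Type*} [NormedAddCommGroup V] [MeasurableSpace V] {μ ν ξ : Measure V}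
  {p q S T : V → V} {r r' ε ε' ℓ : ℝ≥0}

lemma ae_of_ae (hT : IsApproxTransport μ ν p T r ε) {P : V → Prop} (h : ∀ᵐ y ∂ν, P y) :
    ∀ᵐ x ∂μ, P (T x) :=
  ae_of_ae_map hT.measurable.aemeasurable (hT.map_eq ▸ h)

lemma comp (hS : IsApproxTransport ν ξ q S r' ε') (hT : IsApproxTransport μ ν p T r ε)
    (hq : LipschitzWith ℓ q) :
    IsApproxTransport μ ξ (p + q) (S ∘ T) (r + r') (ε + ε' + ℓ * r) where
  measurable := hS.measurable.comp hT.measurable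
  map_eq := by rw [← Measure.map_map hS.measurable hT.measurable, hT.map_eq, hS.map_eq]
  norm_sub_le := by
    filter_upwards [hT.norm_sub_le, hT.ae_of_ae hS.norm_sub_le] with x hTx hSx
    push_cast
    rw [add_comm]
    exact (norm_sub_le_norm_sub_add_norm_sub _ (T x) _).trans (add_le_add hSx hTx)
  norm_sub_sub_le := by
    filter_upwards [hT.norm_sub_le, hT.norm_sub_sub_le, hT.ae_of_ae hS.norm_sub_sub_le]
      with x hr hTx hSx
    calc ‖(S ∘ T) x - x - (p + q) x‖
      _ = ‖(T x - x - p x) + (S (T x) - T x - q (T x)) + (q (T x) - q x)‖ := by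
          congr 1
          simp only [Function.comp_apply, Pi.add_apply]
          abel
      _ ≤ ε + ε' + ℓ * r := norm_add₃_le.trans (add_le_add (add_le_add hTx hSx)
          ((hq.norm_sub_le _ _).trans (mul_le_mul_of_nonneg_left hr ℓ.2)))
      _ = ↑(ε + ε' + ℓ * r) := by push_cast; rfl

lemma integral_comp_eq [BorelSpace V] (hT : IsApproxTransport μ ν p T r ε) {f : V → ℝ}
    (hf : Continuous f) : ∫ x, f (T x) ∂μ = ∫ y, f y ∂ν := by
  rw [← hT.map_eq, integral_map hT.measurable.aemeasurable hf.aestronglyMeasurable]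

lemma integrable_comp (hT : IsApproxTransport μ ν p T r ε) {f : V → ℝ} (hf : Integrable f ν) :
    Integrable (fun x => f (T x)) μ :=
  (hT.map_eq ▸ hf).comp_measurable hT.measurable

end Normed

lemma wassEDist_le {d : ℕ} {μ ν₁ ν₂ : Measure (Eucl d)} [IsProbabilityMeasure μ]
    {p₁ p₂ T₁ T₂ : Eucl d → Eucl d} {r₁ r₂ ε₁ ε₂ : ℝ≥0} (h₁ : IsApproxTransport μ ν₁ p₁ T₁ r₁ ε₁)
    (h₂ : IsApproxTransport μ ν₂ p₂ T₂ r₂ ε₂) : wassEDist ν₁ ν₂ ≤ ↑(r₁ + r₂) := by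
  rw [← h₁.map_eq, ← h₂.map_eq]
  refine wassEDist_map_le h₁.measurable h₂.measurable ?_
  filter_upwards [h₁.norm_sub_le, h₂.norm_sub_le] with x hx₁ hx₂
  rw [edist_nndist, ENNReal.coe_le_coe, ← NNReal.coe_le_coe, coe_nndist, NNReal.coe_add]
  rw [← dist_eq_norm] at hx₁ hx₂
  exact (dist_triangle_right _ _ x).trans (add_le_add hx₁ hx₂)

section Hilbert

variable {H : Type*} [NormedAddCommGroup H] [InnerProductSpace ℝ H] [CompleteSpace H]
  [MeasurableSpace H] {μ ν : Measure H}

lemma lpNorm_sub_le_of_hasGradientAt [BorelSpace H] [IsProbabilityMeasure μ] {p₁ p₂ T₁ T₂ : H → H}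
    {r₁ r₂ ε₁ ε₂ ℓ : ℝ≥0} (h₁ : IsApproxTransport μ ν p₁ T₁ r₁ ε₁)
    (h₂ : IsApproxTransport μ ν p₂ T₂ r₂ ε₂) {u : H → ℝ}
    (hu : ∀ x, HasGradientAt u ((p₁ - p₂) x) x) (hℓ : LipschitzWith ℓ (p₁ - p₂))
    (hui : Integrable u ν) (hp : MemLp (p₁ - p₂) 2 μ) :
    lpNorm (p₁ - p₂) 2 μ ≤ 2 * (ε₁ + ε₂ + ℓ * (r₁ + r₂)) := by
  set w := p₁ - p₂ with hw
  set e : ℝ := ε₁ + ε₂ + ℓ * (r₁ + r₂)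
  have huc : Continuous u := (contDiff_one_of_hasGradientAt hu hℓ.continuous).continuous
  have hu₁ := h₁.integrable_comp hui
  have hu₂ := h₂.integrable_comp hui
  have hmean : ∫ x, (u (T₁ x) - u (T₂ x)) ∂μ = 0 := by
    rw [integral_sub hu₁ hu₂, h₁.integral_comp_eq huc, h₂.integral_comp_eq huc, sub_self]
  have hpoint : ∀ᵐ x ∂μ, ‖w x‖ ^ 2 ≤ 2 * (u (T₁ x) - u (T₂ x)) + 4 * e ^ 2 := by
    filter_upwards [h₁.norm_sub_le, h₂.norm_sub_le, h₁.norm_sub_sub_le, h₂.norm_sub_sub_le]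
      with x hr₁ hr₂ hε₁ hε₂
    refine norm_sq_le_of_hasGradientAt hu hℓ (hr₁.trans (le_add_of_nonneg_right r₂.2))
      (hr₂.trans (le_add_of_nonneg_left r₁.2)) ?_
    rw [show T₁ x - T₂ x - w x = (T₁ x - x - p₁ x) - (T₂ x - x - p₂ x) by
      simp only [hw, Pi.sub_apply]; abel]
    exact (_root_.norm_sub_le _ _).trans (add_le_add hε₁ hε₂)
  have hdiff : Integrable (fun x => 2 * (u (T₁ x) - u (T₂ x))) μ := (hu₁.sub hu₂).const_mul 2
  have hsq : lpNorm w 2 μ ^ 2 ≤ (2 * e) ^ 2 :=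
    calc lpNorm w 2 μ ^ 2 = ∫ x, ‖w x‖ ^ 2 ∂μ := (integral_norm_sq_eq_lpNorm_sq hp).symm
      _ ≤ ∫ x, (2 * (u (T₁ x) - u (T₂ x)) + 4 * e ^ 2) ∂μ :=
          integral_mono_ae (hp.integrable_norm_pow two_ne_zero)
            (hdiff.add (integrable_const _)) hpoint
      _ = (2 * e) ^ 2 := by
          rw [integral_add hdiff (integrable_const _), integral_const_mul, hmean]
          simp only [mul_zero, integral_const, probReal_univ, one_smul, zero_add]
          ring
  exact le_of_sq_le_sq hsq (by positivity)

lemma integral_norm_sq_sub_le [BorelSpace H] [IsProbabilityMeasure μ] {p T : H → H} {r ε A L : ℝ≥0}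
    (hT : IsApproxTransport μ ν p T r ε) {ψ : H → ℝ} (hψ : ∀ x, HasGradientAt ψ (p x) x)
    (hA : ∀ x, ‖p x‖ ≤ A) (hL : LipschitzWith L p) (hp : MemLp p 2 μ) (hψμ : Integrable ψ μ)
    (hψν : Integrable ψ ν) :
    ∫ x, ‖p x‖ ^ 2 ∂μ - (A * ε + L * r ^ 2) ≤ ∫ y, ψ y ∂ν - ∫ x, ψ x ∂μ := by
  have hψT := hT.integrable_comp hψν
  have hp2 := hp.integrable_norm_pow two_ne_zero
  rw [← hT.integral_comp_eq (contDiff_one_of_hasGradientAt hψ hL.continuous).continuous,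
    ← integral_sub hψT hψμ]
  calc ∫ x, ‖p x‖ ^ 2 ∂μ - (A * ε + L * r ^ 2)
    _ = ∫ x, (‖p x‖ ^ 2 - (A * ε + L * r ^ 2)) ∂μ := by
        rw [integral_sub hp2 (integrable_const _), integral_const]; simp
    _ ≤ ∫ x, (ψ (T x) - ψ x) ∂μ := by
        refine integral_mono_ae (hp2.sub (integrable_const _)) (hψT.sub hψμ) ?_
        filter_upwards [hT.norm_sub_le, hT.norm_sub_sub_le] with x hr hε
        have hTaylor := abs_sub_sub_inner_le_of_hasGradientAt hψ hL (x := x) (z := x)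
          (by simp) hr
        have hinner : ‖p x‖ ^ 2 - ‖p x‖ * ε ≤ inner ℝ (p x) (T x - x) :=
          norm_sq_sub_norm_mul_le_inner hε
        have hpε : ‖p x‖ * ε ≤ A * ε := by gcongr; exact hA x
        have hLr : (L : ℝ) * r * ‖T x - x‖ ≤ L * r ^ 2 := by
          rw [sq, ← mul_assoc]
          gcongr
        linarith [neg_le_of_abs_le hTaylor]

end Hilbert

end IsApproxTransport

lemma ofReal_sub_sq_le {P δ m : ℝ} (hδ : 0 ≤ δ) (hm : m ≤ P * δ) :
    ENNReal.ofReal (P - δ) ^ 2 ≤ ENNReal.ofReal (P ^ 2 - m) := by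
  rcases le_total P δ with h | h
  · simp [ENNReal.ofReal_of_nonpos (sub_nonpos.2 h)]
  · rw [← ENNReal.ofReal_pow (sub_nonneg.2 h)]
    exact ENNReal.ofReal_le_ofReal (by nlinarith)

lemma IsApproxTransport.ofReal_lpNorm_sub_sq_le_energy {d : ℕ} {ρ : ℝ → Measure (Eucl d)}
    {p T : Eucl d → Eucl d} {C K h k : ℝ≥0}
    (hT : IsApproxTransport (ρ 0) (ρ 1) p T (K * h) (K * h ^ 2)) {ψ : Eucl d → ℝ}
    (hψ : ∀ x, HasGradientAt ψ (p x) x) (hp : ContDiff ℝ 1 p) (hA : ∀ x, ‖p x‖ ≤ ↑(C * h))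
    (hL : LipschitzWith (C * h) p) (hP : h ≤ C * lpNorm p 2 (ρ 0))
    (hρ : ∀ t ∈ Icc (0 : ℝ) 1, IsProbabilityMeasure (ρ t))
    (hlip : ∀ s ∈ Icc (0 : ℝ) 1, ∀ t ∈ Icc (0 : ℝ) 1, wassEDist (ρ s) (ρ t) ≤ k * edist s t)
    (hψ₀ : Integrable ψ (ρ 0)) (hψ₁ : Integrable ψ (ρ 1)) :
    ENNReal.ofReal (lpNorm p 2 (ρ 0) -
      (8 * C ^ 2 + C * (8 * C ^ 3 + 2 * C * K + 2 * C * K ^ 2)) * h ^ 2) ^ 2 ≤ energy ρ := by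
  have := hρ 0 (by simp)
  have hp₂ : MemLp p 2 (ρ 0) := MemLp.of_bound hp.continuous.aestronglyMeasurable _ (.of_forall hA)
  set P := lpNorm p 2 (ρ 0)
  have hP₀ : 0 ≤ P := lpNorm_nonneg
  have hPC : P ≤ C * h := by
    simpa using lpNorm_le_lpNorm_add_of_norm_sub_le (by norm_num) hp₂ (MemLp.zero (p := 2))
      (.of_forall fun x => by simpa using hA x)
  rcases le_or_gt (C * h) (1 / 8) with hCh | hCh
  · refine (ofReal_sub_sq_le (m := (8 * C ^ 3 + 2 * C * K + 2 * C * K ^ 2) * h ^ 3)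
      (by positivity) ?_).trans (le_trans (ENNReal.ofReal_le_ofReal ?_)
      (ofReal_sub_integral_norm_sq_le_energy hψ hp hA hL hCh hρ hlip hψ₀))
    · have hcube := mul_le_mul_of_nonneg_left hP
        (by positivity : (0 : ℝ) ≤ (8 * C ^ 3 + 2 * C * K + 2 * C * K ^ 2) * h ^ 2)
      nlinarith [mul_nonneg hP₀ (by positivity : (0 : ℝ) ≤ 8 * C ^ 2 * h ^ 2)]
    · have hψT := hT.integral_norm_sq_sub_le hψ hA hL hp₂ hψ₀ hψ₁
      rw [integral_norm_sq_eq_lpNorm_sq hp₂] at hψT ⊢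
      have hPsq : (C * h : ℝ) * P ^ 2 ≤ C * h * (C * h) ^ 2 := by gcongr
      push_cast at hψT ⊢
      linarith
  · rw [ENNReal.ofReal_of_nonpos, zero_pow two_ne_zero]
    · exact zero_le
    · have hCh' : (1 / 8 : ℝ) < C * h := by exact_mod_cast hCh
      nlinarith [hCh',
        show (0 : ℝ) ≤ C * (8 * C ^ 3 + 2 * C * K + 2 * C * K ^ 2) * h ^ 2 by positivity]

end Transport

section IntrinsicDistance

variable {F : Type*} [NormedAddCommGroup F] [NormedSpace ℝ F]
  {M : Type*} [TopologicalSpace M] [ChartedSpace F M]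
  [RiemannianBundle (fun x : M => TangentSpace 𝓘(ℝ, F) x)]
  {S : Set M} {γ : ℝ → M} {a b : ℝ}

lemma pathELength_le_of_enorm_velocity_le {c : ℝ≥0∞}
    (hc : ∀ t ∈ Icc (0 : ℝ) 1, ‖velocity F γ t‖ₑ ≤ c) (ha : 0 ≤ a) (hb : b ≤ 1) :
    pathELength 𝓘(ℝ, F) γ a b ≤ c * ENNReal.ofReal (b - a) := by
  rw [pathELength_eq_lintegral_mfderiv_Ioo]
  calc ∫⁻ t in Ioo a b, ‖mfderiv 𝓘(ℝ, ℝ) 𝓘(ℝ, F) γ t 1‖ₑ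
    _ ≤ ∫⁻ _ in Ioo a b, c := by
        refine setLIntegral_mono measurable_const fun t ht => ?_
        have hmem : Icc (0 : ℝ) 1 ∈ 𝓝 t := Icc_mem_nhds (ha.trans_lt ht.1) (ht.2.trans_le hb)
        have hvel := hc t (mem_of_mem_nhds hmem)
        rwa [velocity, mfderivWithin_of_mem_nhds hmem] at hvel
    _ = c * ENNReal.ofReal (b - a) := by simp

lemma intrinsicEDist_le_pathELength_comp (hγ : ContMDiffOn 𝓘(ℝ, ℝ) 𝓘(ℝ, F) 1 γ (Icc 0 1))
    (hS : MapsTo γ (Icc 0 1) S) {f : ℝ → ℝ} (hf : ContDiff ℝ 1 f)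
    (hf' : MapsTo f (Icc 0 1) (Icc 0 1)) :
    intrinsicEDist F S (γ (f 0)) (γ (f 1)) ≤ pathELength 𝓘(ℝ, F) (γ ∘ f) 0 1 :=
  iInf₂_le_of_le (γ ∘ f) (hγ.comp hf.contMDiff.contMDiffOn hf') <|
    iInf₂_le_of_le (hS.comp hf') rfl (iInf_le _ rfl)

lemma intrinsicEDist_le_pathELength (hγ : ContMDiffOn 𝓘(ℝ, ℝ) 𝓘(ℝ, F) 1 γ (Icc 0 1))
    (hS : MapsTo γ (Icc 0 1) S) (ha : 0 ≤ a) (hab : a ≤ b) (hb : b ≤ 1) :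
    intrinsicEDist F S (γ a) (γ b) ≤ pathELength 𝓘(ℝ, F) γ a b ∧
      intrinsicEDist F S (γ b) (γ a) ≤ pathELength 𝓘(ℝ, F) γ a b := by
  have hmap : ∀ {x y : ℝ}, x ∈ Icc (0 : ℝ) 1 → y ∈ Icc (0 : ℝ) 1 →
      MapsTo (fun u => x + u * (y - x)) (Icc 0 1) (Icc 0 1) := fun hx hy u hu => by
    simpa [smul_eq_mul] using (convex_Icc (0 : ℝ) 1).add_smul_sub_mem hx hy hu
  have ha' : a ∈ Icc (0 : ℝ) 1 := ⟨ha, hab.trans hb⟩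
  have hb' : b ∈ Icc (0 : ℝ) 1 := ⟨ha.trans hab, hb⟩
  have hmd : MDifferentiableOn 𝓘(ℝ, ℝ) 𝓘(ℝ, F) γ (Icc a b) :=
    (hγ.mdifferentiableOn one_ne_zero).mono (Icc_subset_Icc ha hb)
  constructor
  · have hle := intrinsicEDist_le_pathELength_comp hγ hS (by fun_prop) (hmap ha' hb')
    rw [pathELength_comp_of_monotoneOn zero_le_one (fun x _ y _ hxy => by nlinarith)
      (by fun_prop) (by simpa using hmd)] at hle
    simpa using hle
  · have hle := intrinsicEDist_le_pathELength_comp hγ hS (by fun_prop) (hmap hb' ha')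
    rw [pathELength_comp_of_antitoneOn zero_le_one (fun x _ y _ hxy => by nlinarith)
      (by fun_prop) (by simpa using hmd)] at hle
    simpa using hle

lemma intrinsicEDist_le_of_enorm_velocity_le {c : ℝ≥0∞}
    (hγ : ContMDiffOn 𝓘(ℝ, ℝ) 𝓘(ℝ, F) 1 γ (Icc 0 1)) (hS : MapsTo γ (Icc 0 1) S)
    (hc : ∀ t ∈ Icc (0 : ℝ) 1, ‖velocity F γ t‖ₑ ≤ c) (ha : a ∈ Icc (0 : ℝ) 1)
    (hb : b ∈ Icc (0 : ℝ) 1) : intrinsicEDist F S (γ a) (γ b) ≤ c * edist a b := by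
  rcases le_total a b with hab | hab
  · rw [edist_comm, edist_dist, Real.dist_eq, abs_of_nonneg (sub_nonneg.2 hab)]
    exact (intrinsicEDist_le_pathELength hγ hS ha.1 hab hb.2).1.trans
      (pathELength_le_of_enorm_velocity_le hc ha.1 hb.2)
  · rw [edist_dist, Real.dist_eq, abs_of_nonneg (sub_nonneg.2 hab)]
    exact (intrinsicEDist_le_pathELength hγ hS hb.1 hab ha.2).2.trans
      (pathELength_le_of_enorm_velocity_le hc hb.1 ha.2)

end IntrinsicDistance

section Geodesics

variable {d : ℕ} {F : Type*} [NormedAddCommGroup F] [NormedSpace ℝ F]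
  {M : Type*} [TopologicalSpace M] [ChartedSpace F M]
  [RiemannianBundle (fun x : M => TangentSpace 𝓘(ℝ, F) x)]
  {S : Set M} {D : Set (TangentBundle 𝓘(ℝ, F) M)} {θ : M} {η : TangentSpace 𝓘(ℝ, F) θ}
  {Ω : Set (Eucl d)} {E : M → Measure (Eucl d)}
  {B : ∀ θ : M, TangentSpace 𝓘(ℝ, F) θ →ₗ[ℝ] (Eucl d → Eucl d)}

lemma IsEmbeddingOn.ae_mem (hE : IsEmbeddingOn (F := F) Ω S E) (hθ : θ ∈ S) :
    ∀ᵐ x ∂(E θ), x ∈ Ω :=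
  ae_iff.2 (hE.concentrated θ hθ)

/-- The velocity fields `B_{γ(t)} γ̇(t)` along the curve `γ(t) = exp_θ(t η)`. -/
def geodesicField (B : ∀ θ : M, TangentSpace 𝓘(ℝ, F) θ →ₗ[ℝ] (Eucl d → Eucl d))
    (θ : M) (η : TangentSpace 𝓘(ℝ, F) θ) (t : ℝ) : Eucl d → Eucl d :=
  B (expCurve θ η t) (velocity F (expCurve θ η) t)

namespace IsParameterManifold

lemma expCurve_zero (hS : IsParameterManifold S D)
    (hη : (⟨θ, η⟩ : TangentBundle 𝓘(ℝ, F) M) ∈ D) : expCurve θ η 0 = θ :=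
  congrArg TotalSpace.proj (hS.geodesic θ η hη).2

lemma geodesicField_zero (hS : IsParameterManifold S D)
    (hη : (⟨θ, η⟩ : TangentBundle 𝓘(ℝ, F) M) ∈ D)
    (B : ∀ θ : M, TangentSpace 𝓘(ℝ, F) θ →ₗ[ℝ] (Eucl d → Eucl d)) :
    geodesicField B θ η 0 = B θ η :=
  congrArg (fun p : TangentBundle 𝓘(ℝ, F) M => B p.1 p.2) (hS.geodesic θ η hη).2

lemma riemExp_mem (hS : IsParameterManifold S D)
    (hη : (⟨θ, η⟩ : TangentBundle 𝓘(ℝ, F) M) ∈ D) : riemExp θ η ∈ S := by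
  simpa [expCurve] using hS.mapsTo θ η hη (right_mem_Icc.2 zero_le_one)

lemma intrinsicEDist_expCurve_le (hS : IsParameterManifold S D)
    (hη : (⟨θ, η⟩ : TangentBundle 𝓘(ℝ, F) M) ∈ D) {s t : ℝ} (hs : s ∈ Icc (0 : ℝ) 1)
    (ht : t ∈ Icc (0 : ℝ) 1) :
    intrinsicEDist F S (expCurve θ η s) (expCurve θ η t) ≤ ‖η‖₊ * edist s t :=
  intrinsicEDist_le_of_enorm_velocity_le ((hS.geodesic θ η hη).1.smooth.of_le (by simp))
    (hS.mapsTo θ η hη)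
    (fun u hu => by rw [← ofReal_norm, hS.speed θ η hη u hu, ofReal_norm, enorm_eq_nnnorm]) hs ht

lemma isLipCurveOn_expCurve (hS : IsParameterManifold S D)
    (hη : (⟨θ, η⟩ : TangentBundle 𝓘(ℝ, F) M) ∈ D) : IsLipCurveOn F S (expCurve θ η) :=
  ⟨hS.mapsTo θ η hη, ‖η‖₊, fun _ hs _ ht => hS.intrinsicEDist_expCurve_le hη hs ht⟩

lemma isLipCurveIn_expCurve (hS : IsParameterManifold S D) (hE : IsEmbeddingOn (F := F) Ω S E)
    (hη : (⟨θ, η⟩ : TangentBundle 𝓘(ℝ, F) M) ∈ D) :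
    IsLipCurveIn (E '' S) fun t => E (expCurve θ η t) := by
  obtain ⟨L, hL⟩ := hE.biLipschitz
  have hmem := hS.mapsTo θ η hη
  refine ⟨fun t ht => mem_image_of_mem E (hmem ht), L * ‖η‖₊, fun s hs t ht => ?_⟩
  rw [ENNReal.coe_mul, mul_assoc]
  refine (hL _ (hmem hs) _ (hmem ht)).1.trans ?_
  gcongr
  exact hS.intrinsicEDist_expCurve_le hη hs ht

lemma exists_enorm_le_mul_wassEDist (hS : IsParameterManifold S D)
    (hE : IsEmbeddingOn (F := F) Ω S E) :
    ∃ L : ℝ≥0, ∀ (θ : M) (η : TangentSpace 𝓘(ℝ, F) θ),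
      (⟨θ, η⟩ : TangentBundle 𝓘(ℝ, F) M) ∈ D →
        ‖η‖ₑ ≤ L * wassEDist (E θ) (E (riemExp θ η)) := by
  obtain ⟨L, hL⟩ := hE.biLipschitz
  exact ⟨L, fun θ η hη => (hS.minimizing θ η hη).trans_le
    (hL θ (hS.base_mem θ η hη) _ (hS.riemExp_mem hη)).2⟩

lemma exists_nnnorm_le (hS : IsParameterManifold S D) (hΩ : Bornology.IsBounded Ω)
    (hE : IsEmbeddingOn (F := F) Ω S E) :
    ∃ R : ℝ≥0, ∀ (θ : M) (η : TangentSpace 𝓘(ℝ, F) θ),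
      (⟨θ, η⟩ : TangentBundle 𝓘(ℝ, F) M) ∈ D → ‖η‖₊ ≤ R := by
  obtain ⟨L, hL⟩ := hS.exists_enorm_le_mul_wassEDist hE
  refine ⟨L * (Metric.ediam Ω).toNNReal, fun θ η hη => ?_⟩
  have hθ := hS.base_mem θ η hη
  have hθ' := hS.riemExp_mem hη
  have := hE.isProbabilityMeasure θ hθ
  have := hE.isProbabilityMeasure _ hθ'
  rw [← ENNReal.coe_le_coe, ← enorm_eq_nnnorm, ENNReal.coe_mul,
    ENNReal.coe_toNNReal hΩ.ediam_ne_top]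
  refine (hL θ η hη).trans ?_
  gcongr
  exact wassEDist_le_ediam (hE.ae_mem hθ) (hE.ae_mem hθ')

end IsParameterManifold

/-- The control, with constant `C`, of the velocity fields along the geodesic `t ↦ exp_θ(t η)`. Only
the initial field is Lipschitz in space: the later tangent vectors need not belong to `D`. -/
structure HasFieldBounds (E : M → Measure (Eucl d))
    (B : ∀ θ : M, TangentSpace 𝓘(ℝ, F) θ →ₗ[ℝ] (Eucl d → Eucl d))
    (θ : M) (η : TangentSpace 𝓘(ℝ, F) θ) (C : ℝ≥0) : Prop where
  geodesicField_zero : geodesicField B θ η 0 = B θ η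
  contDiff : ContDiff ℝ 1 (B θ η)
  norm_le_mul_lpNorm : ‖η‖ ≤ C * lpNorm (B θ η) 2 (E θ)
  isTimeLipschitzField : IsTimeLipschitzField (geodesicField B θ η) (C * ‖η‖₊) (C * ‖η‖₊ ^ 2)

namespace HasFieldBounds

variable {C : ℝ≥0}

lemma norm_apply_le (hC : HasFieldBounds E B θ η C) (x : Eucl d) :
    ‖B θ η x‖ ≤ ↑(C * ‖η‖₊) := by
  rw [← hC.geodesicField_zero]
  exact hC.isTimeLipschitzField.norm_init_le x

lemma lipschitzWith (hC : HasFieldBounds E B θ η C) : LipschitzWith (C * ‖η‖₊) (B θ η) := by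
  rw [← hC.geodesicField_zero]
  exact hC.isTimeLipschitzField.lipschitz_init

lemma memLp (hC : HasFieldBounds E B θ η C) (μ : Measure (Eucl d)) [IsFiniteMeasure μ] :
    MemLp (B θ η) 2 μ :=
  MemLp.of_bound hC.contDiff.continuous.aestronglyMeasurable _ (.of_forall hC.norm_apply_le)

end HasFieldBounds

lemma IsVelocityFamily.exists_hasFieldBounds (hB : IsVelocityFamily S D E B)
    (hS : IsParameterManifold S D) :
    ∃ C : ℝ≥0, ∀ (θ : M) (η : TangentSpace 𝓘(ℝ, F) θ),
      (⟨θ, η⟩ : TangentBundle 𝓘(ℝ, F) M) ∈ D → HasFieldBounds E B θ η C := by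
  obtain ⟨C, hC, hbounds⟩ := hB.bounds
  lift C to ℝ≥0 using hC.le
  refine ⟨C, fun θ η hη => ?_⟩
  obtain ⟨⟨hlower, -⟩, hspace, htime⟩ := hbounds θ η hη
  have hsmooth := hB.contDiff θ (hS.base_mem θ η hη) η
  have hzero := hS.geodesicField_zero hη B
  refine ⟨hzero, hsmooth, ?_, fun t ht => ?_, fun x => ?_, fun x => ?_, ?_⟩
  · rwa [div_mul_eq_mul_div, one_mul, div_le_iff₀' hC] at hlower
  · exact (hB.contDiff _ (hS.mapsTo θ η hη ht) _).continuous
  · choose! v' hv' using htime x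
    exact (convex_Icc (0 : ℝ) 1).lipschitzOnWith_of_nnnorm_hasDerivWithin_le
      (fun t ht => (hv' t ht).1) fun t ht => (hv' t ht).2
  · rw [hzero]
    exact (hspace x).1
  · rw [hzero]
    exact lipschitzWith_of_nnnorm_fderiv_le (hsmooth.differentiable one_ne_zero)
      fun x => (hspace x).2

end Geodesics

section FlowEstimates

lemma IsApproxTransport.mono {V : Type*} [NormedAddCommGroup V] [MeasurableSpace V]
    {μ ν : Measure V} {p T : V → V} {r r' ε ε' : ℝ≥0} (hT : IsApproxTransport μ ν p T r ε)
    (hr : r ≤ r') (hε : ε ≤ ε') : IsApproxTransport μ ν p T r' ε' where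
  measurable := hT.measurable
  map_eq := hT.map_eq
  norm_sub_le := hT.norm_sub_le.mono fun _ hx => hx.trans hr
  norm_sub_sub_le := hT.norm_sub_sub_le.mono fun _ hx => hx.trans hε

lemma IsApproxTransport.abs_lpNorm_sub_lpNorm_le {V W : Type*} [NormedAddCommGroup V]
    [MeasurableSpace V] [NormedAddCommGroup W] {μ ν : Measure V} [IsProbabilityMeasure μ]
    {p T : V → V} {r ε ℓ : ℝ≥0} (hT : IsApproxTransport μ ν p T r ε) {q : V → W}
    (hq : LipschitzWith ℓ q) {s : ℝ≥0∞} (hs : 1 ≤ s) (hqμ : MemLp q s μ) (hqν : MemLp q s ν) :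
    |lpNorm q s ν - lpNorm q s μ| ≤ ℓ * r := by
  have hqT : MemLp (q ∘ T) s μ := (hT.map_eq ▸ hqν).comp_of_map hT.measurable.aemeasurable
  have hcomp : lpNorm q s ν = lpNorm (q ∘ T) s μ := by
    rw [← toReal_eLpNorm hqν.1, ← toReal_eLpNorm hqT.1, ← eLpNorm_map_measure
      (hT.map_eq ▸ hqν.1) hT.measurable.aemeasurable, hT.map_eq]
  have hclose : ∀ᵐ x ∂μ, ‖(q ∘ T) x - q x‖ ≤ ℓ * r := hT.norm_sub_le.mono fun x hx =>
    (hq.norm_sub_le _ _).trans (mul_le_mul_of_nonneg_left hx ℓ.2)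
  rw [hcomp, abs_sub_le_iff, sub_le_iff_le_add', sub_le_iff_le_add']
  exact ⟨lpNorm_le_lpNorm_add_of_norm_sub_le hs hqT hqμ hclose,
    lpNorm_le_lpNorm_add_of_norm_sub_le hs hqμ hqT (by simpa only [norm_sub_rev] using hclose)⟩

namespace IsSolutionMap

lemma isApproxTransport {V : Type*} [NormedAddCommGroup V] [NormedSpace ℝ V] [CompleteSpace V]
    [MeasurableSpace V] {v Φ : ℝ → V → V} {a b : ℝ≥0} (hΦ : IsSolutionMap v Φ)
    (hv : IsTimeLipschitzField v a b) (μ : Measure V) :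
    IsApproxTransport μ (μ.map (Φ 1)) (v 0) (Φ 1) (a + b) (b + a * (a + b)) where
  measurable := hΦ.measurable 1
  map_eq := rfl
  norm_sub_le := .of_forall fun x => hΦ.norm_sub_le hv x (by simp)
  norm_sub_sub_le := .of_forall fun x => hΦ.norm_displacement_sub_le hv x

lemma energy_map_rpow_half_le {d : ℕ} {v Φ : ℝ → Eucl d → Eucl d} {a b : ℝ≥0} {Ω : Set (Eucl d)}
    {μ : Measure (Eucl d)} [IsProbabilityMeasure μ] (hΦ : IsSolutionMap v Φ)
    (hv : IsTimeLipschitzField v a b) (hΩ : Bornology.IsBounded Ω) (hμ : ∀ᵐ x ∂μ, x ∈ Ω) :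
    energy (fun t => μ.map (Φ t)) ^ (1 / 2 : ℝ) ≤
      ENNReal.ofReal (lpNorm (v 0) 2 μ + (b + a * (a + b))) := by
  have hCE := hΦ.isContinuityEq_map hv hΩ hμ
  have hv₀ : MemLp (v 0) 2 μ := MemLp.of_bound
    (hv.continuous 0 (by simp)).aestronglyMeasurable _ (.of_forall hv.norm_init_le)
  set c := ENNReal.ofReal (lpNorm (v 0) 2 μ + (b + a * (a + b)))
  have hnorm : ∀ t ∈ Icc (0 : ℝ) 1,
      eLpNorm (fun x => clampField v (t, x)) 2 (μ.map (Φ t)) ≤ c := by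
    intro t ht
    have hΦt := (hΦ.measurable t).aemeasurable (μ := μ)
    have hvt := (hCE.memLp t ht).comp_of_map hΦt
    rw [eLpNorm_map_measure (hCE.memLp t ht).1 hΦt, ← ofReal_lpNorm hvt]
    refine ENNReal.ofReal_le_ofReal (lpNorm_le_lpNorm_add_of_norm_sub_le (by norm_num) hvt hv₀
      (.of_forall fun x => ?_))
    simpa only [Function.comp_apply, clampField_of_mem v ht]
      using hΦ.norm_field_sub_init_le hv x ht
  have hsq : energy (fun t => μ.map (Φ t)) ≤ c ^ 2 := (iInf₂_le _ hCE).trans <|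
    calc ∫⁻ t in Icc (0 : ℝ) 1, ∫⁻ x, ‖clampField v (t, x)‖ₑ ^ 2 ∂(μ.map (Φ t))
      _ ≤ ∫⁻ _ in Icc (0 : ℝ) 1, c ^ 2 := by
          refine setLIntegral_mono measurable_const fun t ht => ?_
          rw [lintegral_enorm_sq_eq_eLpNorm_sq]
          gcongr
          exact hnorm t ht
      _ = c ^ 2 := by simp
  exact (ENNReal.rpow_le_rpow hsq (by norm_num)).trans_eq (ennreal_sq_rpow_half c)

end IsSolutionMap

end FlowEstimates

section TransportTriangle

lemma IsApproxTransport.le_mul_of_le_mul_wassEDist {d : ℕ} {μ ν₁ ν₂ : Measure (Eucl d)}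
    [IsProbabilityMeasure μ] {p₁ p₂ T₁ T₂ : Eucl d → Eucl d} {r₁ r₂ ε₁ ε₂ L m : ℝ≥0}
    (h₁ : IsApproxTransport μ ν₁ p₁ T₁ r₁ ε₁) (h₂ : IsApproxTransport μ ν₂ p₂ T₂ r₂ ε₂)
    (hm : m ≤ L * wassEDist ν₁ ν₂) : m ≤ L * (r₁ + r₂) := by
  rw [← ENNReal.coe_le_coe, ENNReal.coe_mul]
  exact hm.trans (mul_le_mul_right (h₁.wassEDist_le h₂) _)

lemma abs_lpNorm_sub_lpNorm_le_lpNorm_sub {α V : Type*} [MeasurableSpace α]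
    [NormedAddCommGroup V] {μ : Measure α} {f g : α → V} {p : ℝ≥0∞} (hp : 1 ≤ p)
    (hf : MemLp f p μ) (hg : MemLp g p μ) : |lpNorm f p μ - lpNorm g p μ| ≤ lpNorm (f - g) p μ := by
  rw [abs_sub_le_iff, sub_le_iff_le_add', sub_le_iff_le_add']
  exact ⟨lpNorm_le_lpNorm_add_lpNorm_sub' hg hp, lpNorm_le_lpNorm_add_lpNorm_sub hf hp⟩

lemma hasGradientAt_sub_add {H : Type*} [NormedAddCommGroup H] [InnerProductSpace ℝ H]
    [CompleteSpace H] {ψ₁ ψ₂ ψ₃ : H → ℝ} {p₁ p₂ p₃ x : H} (h₁ : HasGradientAt ψ₁ p₁ x)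
    (h₂ : HasGradientAt ψ₂ p₂ x) (h₃ : HasGradientAt ψ₃ p₃ x) :
    HasGradientAt (ψ₁ - (ψ₂ + ψ₃)) (p₁ - (p₂ + p₃)) x := by
  rw [hasGradientAt_iff_hasFDerivAt] at *
  simpa only [map_sub, map_add] using h₁.sub (h₂.add h₃)

lemma IsApproxTransport.lpNorm_sub_add_le_of_hasGradientAt {H : Type*} [NormedAddCommGroup H]
    [InnerProductSpace ℝ H] [CompleteSpace H] [MeasurableSpace H] [BorelSpace H]
    {μ ν ξ : Measure H} [IsProbabilityMeasure μ] {p₁ p₂ q T₁ T₂ S : H → H}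
    {A C K n₁ n₂ m : ℝ≥0} (h₁ : IsApproxTransport μ ν p₁ T₁ (K * n₁) (K * n₁ ^ 2))
    (h₂ : IsApproxTransport μ ξ p₂ T₂ (K * n₂) (K * n₂ ^ 2))
    (hS : IsApproxTransport ν ξ q S (K * m) (K * m ^ 2)) (hp₁ : LipschitzWith (C * n₁) p₁)
    (hp₂ : LipschitzWith (C * n₂) p₂) (hq : LipschitzWith (C * m) q) (hm : m ≤ A * (n₁ + n₂))
    {u : H → ℝ} (hu : ∀ x, HasGradientAt u ((p₂ - (p₁ + q)) x) x) (hui : Integrable u ξ)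
    (hp : MemLp (p₂ - (p₁ + q)) 2 μ) :
    lpNorm (p₂ - (p₁ + q)) 2 μ ≤
      2 * (K * (1 + A ^ 2 + C * A + C * (1 + A) ^ 2)) * (n₁ + n₂) ^ 2 := by
  refine (h₂.lpNorm_sub_le_of_hasGradientAt (hS.comp h₁ hq) hu (hp₂.sub (hp₁.add hq)) hui hp).trans
    ?_
  norm_cast
  set τ := n₁ + n₂ with hτ
  have hn₁ : n₁ ≤ τ := le_self_add
  have hn : n₁ ^ 2 + n₂ ^ 2 ≤ τ ^ 2 := by
    rw [hτ, add_sq, add_right_comm]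
    exact le_self_add
  calc 2 * (K * n₂ ^ 2 + (K * n₁ ^ 2 + K * m ^ 2 + C * m * (K * n₁)) +
        (C * n₂ + (C * n₁ + C * m)) * (K * n₂ + (K * n₁ + K * m)))
    _ = 2 * (K * ((n₁ ^ 2 + n₂ ^ 2) + m ^ 2 + C * m * n₁ + C * (τ + m) ^ 2)) := by
        rw [hτ]
        ring
    _ ≤ 2 * (K * (τ ^ 2 + (A * τ) ^ 2 + C * (A * τ) * τ + C * (τ + A * τ) ^ 2)) := by gcongr
    _ = 2 * (K * (1 + A ^ 2 + C * A + C * (1 + A) ^ 2)) * τ ^ 2 := by ring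

lemma IsApproxTransport.abs_lpNorm_sub_lpNorm_sub_le_of_hasGradientAt {H : Type*}
    [NormedAddCommGroup H] [InnerProductSpace ℝ H] [CompleteSpace H] [MeasurableSpace H]
    [BorelSpace H] {μ ν ξ : Measure H} [IsProbabilityMeasure μ] {p₁ p₂ q T₁ T₂ S : H → H}
    {A C K n₁ n₂ m : ℝ≥0} (h₁ : IsApproxTransport μ ν p₁ T₁ (K * n₁) (K * n₁ ^ 2))
    (h₂ : IsApproxTransport μ ξ p₂ T₂ (K * n₂) (K * n₂ ^ 2))
    (hS : IsApproxTransport ν ξ q S (K * m) (K * m ^ 2)) (hp₁ : LipschitzWith (C * n₁) p₁)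
    (hp₂ : LipschitzWith (C * n₂) p₂) (hq : LipschitzWith (C * m) q) (hm : m ≤ A * (n₁ + n₂))
    {u : H → ℝ} (hu : ∀ x, HasGradientAt u ((p₂ - (p₁ + q)) x) x) (hui : Integrable u ξ)
    (hp₁μ : MemLp p₁ 2 μ) (hp₂μ : MemLp p₂ 2 μ) (hqμ : MemLp q 2 μ) (hqν : MemLp q 2 ν) :
    |lpNorm q 2 ν - lpNorm (p₁ - p₂) 2 μ| ≤
      (C * A * K + 2 * (K * (1 + A ^ 2 + C * A + C * (1 + A) ^ 2))) * (n₁ + n₂) ^ 2 := by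
  have hdefect := h₁.lpNorm_sub_add_le_of_hasGradientAt h₂ hS hp₁ hp₂ hq hm hu hui
    (hp₂μ.sub (hp₁μ.add hqμ))
  have hdiff := abs_lpNorm_sub_lpNorm_le_lpNorm_sub one_le_two hqμ (hp₂μ.sub hp₁μ)
  have hmove := h₁.abs_lpNorm_sub_lpNorm_le hq one_le_two hqμ hqν
  have hcost : C * m * (K * n₁) ≤ C * A * K * (n₁ + n₂) ^ 2 :=
    calc C * m * (K * n₁) ≤ C * (A * (n₁ + n₂)) * (K * (n₁ + n₂)) := by
          gcongr
          exact le_self_add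
      _ = C * A * K * (n₁ + n₂) ^ 2 := by ring
  rw [lpNorm_sub_comm q, sub_sub] at hdiff
  rw [lpNorm_sub_comm p₁]
  calc |lpNorm q 2 ν - lpNorm (p₂ - p₁) 2 μ|
    _ ≤ |lpNorm q 2 ν - lpNorm q 2 μ| + |lpNorm q 2 μ - lpNorm (p₂ - p₁) 2 μ| := abs_sub_le _ _ _
    _ ≤ C * A * K * (n₁ + n₂) ^ 2 +
        2 * (K * (1 + A ^ 2 + C * A + C * (1 + A) ^ 2)) * (n₁ + n₂) ^ 2 :=
        add_le_add (hmove.trans (by exact_mod_cast hcost)) (hdiff.trans hdefect)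
    _ = _ := by ring

end TransportTriangle

section GeodesicRestriction

lemma ne_top_and_abs_toReal_sub_le {x : ℝ≥0∞} {a c : ℝ} (hac : 0 ≤ a + c)
    (hl : ENNReal.ofReal (a - c) ≤ x) (hu : x ≤ ENNReal.ofReal (a + c)) :
    x ≠ ⊤ ∧ |x.toReal - a| ≤ c := by
  have hx : x ≠ ⊤ := ne_top_of_le_ne_top ENNReal.ofReal_ne_top hu
  have hl' := (ENNReal.ofReal_le_iff_le_toReal hx).1 hl
  have hu' := ENNReal.toReal_le_of_le_ofReal hac hu
  exact ⟨hx, abs_sub_le_iff.2 ⟨by linarith, by linarith⟩⟩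

variable {d : ℕ} {F : Type*} [NormedAddCommGroup F] [NormedSpace ℝ F]
  {M : Type*} [TopologicalSpace M] [ChartedSpace F M]
  [RiemannianBundle (fun x : M => TangentSpace 𝓘(ℝ, F) x)]
  {S : Set M} {D : Set (TangentBundle 𝓘(ℝ, F) M)} {θ : M} {η : TangentSpace 𝓘(ℝ, F) θ}
  {Ω : Set (Eucl d)} {E : M → Measure (Eucl d)}
  {B : ∀ θ : M, TangentSpace 𝓘(ℝ, F) θ →ₗ[ℝ] (Eucl d → Eucl d)}

lemma geodRestrEDist_le_of_eqOn {L : Set (Measure (Eucl d))} {ρ σ : ℝ → Measure (Eucl d)}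
    (hσ : IsLipCurveIn L σ) (h : EqOn ρ σ (Icc 0 1)) :
    geodRestrEDist L (σ 0) (σ 1) ≤ energy ρ ^ (1 / 2 : ℝ) := by
  obtain ⟨hL, k, hk⟩ := hσ
  refine iInf₂_le_of_le ρ ⟨fun t ht => h ht ▸ hL t ht, k, fun s hs t ht => ?_⟩
    (iInf₂_le (h (by simp)) (h (by simp)))
  rw [h hs, h ht]
  exact hk s hs t ht

lemma displacement_bound_le {C R n : ℝ≥0} (hn : n ≤ R) :
    C * n ^ 2 + C * n * (C * n + C * n ^ 2) ≤ C * (1 + C) * (1 + R) * n ^ 2 :=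
  calc C * n ^ 2 + C * n * (C * n + C * n ^ 2)
    _ = C * (1 + C * (1 + n)) * n ^ 2 := by ring
    _ ≤ C * ((1 + R) + C * (1 + R)) * n ^ 2 := by gcongr; exact le_self_add
    _ = C * (1 + C) * (1 + R) * n ^ 2 := by ring

namespace HasFieldBounds

variable {C R : ℝ≥0}

lemma exists_isSolutionMap_map_eq (hC : HasFieldBounds E B θ η C)
    (hS : IsParameterManifold S D) (hcons : IsConsistent Ω S E B)
    (hη : (⟨θ, η⟩ : TangentBundle 𝓘(ℝ, F) M) ∈ D) :
    ∃ Φ, IsSolutionMap (geodesicField B θ η) Φ ∧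
      ∀ t ∈ Icc (0 : ℝ) 1, (E θ).map (Φ t) = E (expCurve θ η t) := by
  obtain ⟨Φ, hΦ⟩ := hC.isTimeLipschitzField.exists_isSolutionMap
  refine ⟨Φ, hΦ, fun t ht => ?_⟩
  have hmap := hcons (expCurve θ η) (hS.isLipCurveOn_expCurve hη) Φ
    (hΦ.isFlow hC.isTimeLipschitzField Ω _) t ht
  rw [hmap, hS.expCurve_zero hη]

lemma exists_isApproxTransport (hC : HasFieldBounds E B θ η C)
    (hS : IsParameterManifold S D) (hcons : IsConsistent Ω S E B)
    (hη : (⟨θ, η⟩ : TangentBundle 𝓘(ℝ, F) M) ∈ D) (hR : ‖η‖₊ ≤ R) :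
    ∃ T, IsApproxTransport (E θ) (E (riemExp θ η)) (B θ η) T
      (C * (1 + C) * (1 + R) * ‖η‖₊) (C * (1 + C) * (1 + R) * ‖η‖₊ ^ 2) := by
  obtain ⟨Φ, hΦ, hmap⟩ := hC.exists_isSolutionMap_map_eq hS hcons hη
  have hT := hΦ.isApproxTransport hC.isTimeLipschitzField (E θ)
  rw [hmap 1 (by simp), expCurve, one_smul, hC.geodesicField_zero] at hT
  refine ⟨Φ 1, hT.mono ?_ ?_⟩
  · calc C * ‖η‖₊ + C * ‖η‖₊ ^ 2 = C * 1 * (1 + ‖η‖₊) * ‖η‖₊ := by ring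
      _ ≤ C * (1 + C) * (1 + R) * ‖η‖₊ := by gcongr; exact le_self_add
  · exact displacement_bound_le hR

lemma geodRestrEDist_riemExp_le (hC : HasFieldBounds E B θ η C)
    (hS : IsParameterManifold S D) (hE : IsEmbeddingOn (F := F) Ω S E)
    (hΩ : Bornology.IsBounded Ω) (hcons : IsConsistent Ω S E B)
    (hη : (⟨θ, η⟩ : TangentBundle 𝓘(ℝ, F) M) ∈ D) (hR : ‖η‖₊ ≤ R) :
    geodRestrEDist (E '' S) (E θ) (E (riemExp θ η)) ≤
      ENNReal.ofReal (lpNorm (B θ η) 2 (E θ) + C * (1 + C) * (1 + R) * ‖η‖ ^ 2) := by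
  have hθ := hS.base_mem θ η hη
  have := hE.isProbabilityMeasure θ hθ
  obtain ⟨Φ, hΦ, hmap⟩ := hC.exists_isSolutionMap_map_eq hS hcons hη
  have hle := geodRestrEDist_le_of_eqOn (hS.isLipCurveIn_expCurve hE hη) hmap
  simp only [hS.expCurve_zero hη] at hle
  rw [expCurve, one_smul] at hle
  refine hle.trans ((hΦ.energy_map_rpow_half_le hC.isTimeLipschitzField hΩ (hE.ae_mem hθ)).trans
    (ENNReal.ofReal_le_ofReal ?_))
  rw [hC.geodesicField_zero]
  gcongr
  exact_mod_cast displacement_bound_le hR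

lemma integrable_of_hasGradientAt (hC : HasFieldBounds E B θ η C) (hΩ : IsCompact Ω)
    {μ : Measure (Eucl d)} [IsFiniteMeasure μ] (hμ : ∀ᵐ x ∂μ, x ∈ Ω) {ψ : Eucl d → ℝ}
    (hψ : ∀ x, HasGradientAt ψ (B θ η x) x) : Integrable ψ μ :=
  integrable_of_continuous_of_isCompact hΩ hμ
    (contDiff_one_of_hasGradientAt hψ hC.contDiff.continuous).continuous

lemma ofReal_le_geodRestrEDist_riemExp {K : ℝ≥0} {T : Eucl d → Eucl d}
    (hC : HasFieldBounds E B θ η C)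
    (hT : IsApproxTransport (E θ) (E (riemExp θ η)) (B θ η) T (K * ‖η‖₊) (K * ‖η‖₊ ^ 2))
    (hE : IsEmbeddingOn (F := F) Ω S E) (hΩ : IsCompact Ω) (hθ : θ ∈ S) (hη : riemExp θ η ∈ S)
    {ψ : Eucl d → ℝ} (hψ : ∀ x, HasGradientAt ψ (B θ η x) x) :
    ENNReal.ofReal (lpNorm (B θ η) 2 (E θ) -
      (8 * C ^ 2 + C * (8 * C ^ 3 + 2 * C * K + 2 * C * K ^ 2)) * ‖η‖ ^ 2) ≤
      geodRestrEDist (E '' S) (E θ) (E (riemExp θ η)) := by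
  have hint : ∀ x ∈ S, Integrable ψ (E x) := fun x hx => by
    have := hE.isProbabilityMeasure x hx
    exact hC.integrable_of_hasGradientAt hΩ (hE.ae_mem hx) hψ
  refine le_iInf₂ fun ρ ⟨hρ, k, hk⟩ => le_iInf₂ fun h₀ h₁ => ?_
  have hprob : ∀ t ∈ Icc (0 : ℝ) 1, IsProbabilityMeasure (ρ t) := fun t ht => by
    obtain ⟨x, hx, hxt⟩ := hρ t ht
    exact hxt ▸ hE.isProbabilityMeasure x hx
  rw [← ennreal_sq_rpow_half (ENNReal.ofReal _)]
  refine ENNReal.rpow_le_rpow ?_ (by norm_num)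
  have hint₀ := hint θ hθ
  have hint₁ := hint _ hη
  have hnorm := hC.norm_le_mul_lpNorm
  rw [← h₀] at hT hint₀ hnorm ⊢
  rw [← h₁] at hT hint₁
  exact hT.ofReal_lpNorm_sub_sq_le_energy hψ hC.contDiff hC.norm_apply_le hC.lipschitzWith hnorm
    hprob hk hint₀ hint₁

end HasFieldBounds

lemma IsParameterManifold.exists_isApproxTransport {C : ℝ≥0} (hS : IsParameterManifold S D)
    (hE : IsEmbeddingOn (F := F) Ω S E) (hΩ : Bornology.IsBounded Ω) (hcons : IsConsistent Ω S E B)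
    (hC : ∀ (θ : M) (η : TangentSpace 𝓘(ℝ, F) θ),
      (⟨θ, η⟩ : TangentBundle 𝓘(ℝ, F) M) ∈ D → HasFieldBounds E B θ η C) :
    ∃ K : ℝ≥0, ∀ (θ : M) (η : TangentSpace 𝓘(ℝ, F) θ),
      (⟨θ, η⟩ : TangentBundle 𝓘(ℝ, F) M) ∈ D →
        ∃ T, IsApproxTransport (E θ) (E (riemExp θ η)) (B θ η) T (K * ‖η‖₊) (K * ‖η‖₊ ^ 2) := by
  obtain ⟨R, hR⟩ := hS.exists_nnnorm_le hΩ hE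
  exact ⟨_, fun θ η hη => (hC θ η hη).exists_isApproxTransport hS hcons hη (hR θ η hη)⟩

lemma IsVelocityFamily.exists_abs_geodRestrEDist_riemExp_sub_le {C : ℝ≥0}
    (hB : IsVelocityFamily S D E B) (hS : IsParameterManifold S D)
    (hE : IsEmbeddingOn (F := F) Ω S E) (hΩ : IsCompact Ω) (hcons : IsConsistent Ω S E B)
    (hC : ∀ (θ : M) (η : TangentSpace 𝓘(ℝ, F) θ),
      (⟨θ, η⟩ : TangentBundle 𝓘(ℝ, F) M) ∈ D → HasFieldBounds E B θ η C) :
    ∃ K : ℝ≥0, ∀ (θ : M) (η : TangentSpace 𝓘(ℝ, F) θ),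
      (⟨θ, η⟩ : TangentBundle 𝓘(ℝ, F) M) ∈ D →
        geodRestrEDist (E '' S) (E θ) (E (riemExp θ η)) ≠ ⊤ ∧
        |(geodRestrEDist (E '' S) (E θ) (E (riemExp θ η))).toReal - lpNorm (B θ η) 2 (E θ)| ≤
          K * ‖η‖ ^ 2 := by
  obtain ⟨R, hR⟩ := hS.exists_nnnorm_le hΩ.isBounded hE
  obtain ⟨K, hK⟩ := hS.exists_isApproxTransport hE hΩ.isBounded hcons hC
  refine ⟨max (C * (1 + C) * (1 + R)) (8 * C ^ 2 + C * (8 * C ^ 3 + 2 * C * K + 2 * C * K ^ 2)),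
    fun θ η hη => ne_top_and_abs_toReal_sub_le (add_nonneg lpNorm_nonneg (by positivity)) ?_ ?_⟩
  · obtain ⟨T, hT⟩ := hK θ η hη
    have hθ := hS.base_mem θ η hη
    obtain ⟨ψ, hψ⟩ := hB.isGradient θ hθ η
    refine le_trans (ENNReal.ofReal_le_ofReal ?_) ((hC θ η hη).ofReal_le_geodRestrEDist_riemExp hT
      hE hΩ hθ (hS.riemExp_mem hη) hψ)
    gcongr
    exact_mod_cast le_max_right _ _
  · refine ((hC θ η hη).geodRestrEDist_riemExp_le hS hE hΩ.isBounded hcons hη (hR θ η hη)).trans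
      (ENNReal.ofReal_le_ofReal ?_)
    gcongr
    exact_mod_cast le_max_left _ _

lemma IsVelocityFamily.exists_nnnorm_le_and_abs_lpNorm_sub_lpNorm_sub_le
    (hB : IsVelocityFamily S D E B) (hS : IsParameterManifold S D)
    (hE : IsEmbeddingOn (F := F) Ω S E) (hΩ : IsCompact Ω) (hcons : IsConsistent Ω S E B) :
    ∃ A K : ℝ≥0, ∀ (θ : M) (η₁ η₂ : TangentSpace 𝓘(ℝ, F) θ)
      (ζ : TangentSpace 𝓘(ℝ, F) (riemExp θ η₁)),
      (⟨θ, η₁⟩ : TangentBundle 𝓘(ℝ, F) M) ∈ D → (⟨θ, η₂⟩ : TangentBundle 𝓘(ℝ, F) M) ∈ D →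
      (⟨riemExp θ η₁, ζ⟩ : TangentBundle 𝓘(ℝ, F) M) ∈ D →
      riemExp (riemExp θ η₁) ζ = riemExp θ η₂ →
        ‖ζ‖₊ ≤ A * (‖η₁‖₊ + ‖η₂‖₊) ∧
        |lpNorm (B (riemExp θ η₁) ζ) 2 (E (riemExp θ η₁)) - lpNorm (B θ (η₁ - η₂)) 2 (E θ)| ≤
          K * (‖η₁‖ + ‖η₂‖) ^ 2 := by
  obtain ⟨C, hC⟩ := hB.exists_hasFieldBounds hS
  obtain ⟨K, hK⟩ := hS.exists_isApproxTransport hE hΩ.isBounded hcons hC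
  obtain ⟨L, hL⟩ := hS.exists_enorm_le_mul_wassEDist hE
  refine ⟨L * K, C * (L * K) * K +
    2 * (K * (1 + (L * K) ^ 2 + C * (L * K) + C * (1 + L * K) ^ 2)),
    fun θ η₁ η₂ ζ h₁ h₂ hζ hζθ₂ => ?_⟩
  have hθ := hS.base_mem θ η₁ h₁
  have hθ₁ := hS.riemExp_mem h₁
  have hθ₂ := hS.riemExp_mem h₂
  have := hE.isProbabilityMeasure _ hθ
  have := hE.isProbabilityMeasure _ hθ₁
  have := hE.isProbabilityMeasure _ hθ₂
  obtain ⟨T₁, hT₁⟩ := hK θ η₁ h₁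
  obtain ⟨T₂, hT₂⟩ := hK θ η₂ h₂
  obtain ⟨T₃, hT₃⟩ := hK _ ζ hζ
  rw [hζθ₂] at hT₃
  have hζA : ‖ζ‖₊ ≤ L * K * (‖η₁‖₊ + ‖η₂‖₊) :=
    (hT₁.le_mul_of_le_mul_wassEDist hT₂ (hζθ₂ ▸ hL _ ζ hζ)).trans_eq (by ring)
  have hC₁ := hC θ η₁ h₁
  have hC₂ := hC θ η₂ h₂
  have hC₃ := hC _ ζ hζ
  have hae := hE.ae_mem hθ₂
  obtain ⟨ψ₁, hψ₁⟩ := hB.isGradient θ hθ η₁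
  obtain ⟨ψ₂, hψ₂⟩ := hB.isGradient θ hθ η₂
  obtain ⟨ψ₃, hψ₃⟩ := hB.isGradient _ hθ₁ ζ
  rw [map_sub]
  exact ⟨hζA, mod_cast hT₁.abs_lpNorm_sub_lpNorm_sub_le_of_hasGradientAt hT₂ hT₃
    hC₁.lipschitzWith hC₂.lipschitzWith hC₃.lipschitzWith hζA
    (fun x => hasGradientAt_sub_add (hψ₂ x) (hψ₁ x) (hψ₃ x))
    ((hC₂.integrable_of_hasGradientAt hΩ hae hψ₂).sub
      ((hC₁.integrable_of_hasGradientAt hΩ hae hψ₁).add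
        (hC₃.integrable_of_hasGradientAt hΩ hae hψ₃)))
    (hC₁.memLp _) (hC₂.memLp _) (hC₃.memLp _) (hC₃.memLp _)⟩

lemma IsVelocityFamily.exists_abs_geodRestrEDist_riemExp_riemExp_sub_le
    (hB : IsVelocityFamily S D E B) (hS : IsParameterManifold S D)
    (hE : IsEmbeddingOn (F := F) Ω S E) (hΩ : IsCompact Ω) (hcons : IsConsistent Ω S E B) :
    ∃ K : ℝ≥0, ∀ (θ : M) (η₁ η₂ : TangentSpace 𝓘(ℝ, F) θ),
      (⟨θ, η₁⟩ : TangentBundle 𝓘(ℝ, F) M) ∈ D → (⟨θ, η₂⟩ : TangentBundle 𝓘(ℝ, F) M) ∈ D →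
        geodRestrEDist (E '' S) (E (riemExp θ η₁)) (E (riemExp θ η₂)) ≠ ⊤ ∧
        |(geodRestrEDist (E '' S) (E (riemExp θ η₁)) (E (riemExp θ η₂))).toReal -
          lpNorm (B θ (η₁ - η₂)) 2 (E θ)| ≤ K * (‖η₁‖ + ‖η₂‖) ^ 2 := by
  obtain ⟨C, hC⟩ := hB.exists_hasFieldBounds hS
  obtain ⟨K, hK⟩ := hB.exists_abs_geodRestrEDist_riemExp_sub_le hS hE hΩ hcons hC
  obtain ⟨A, K', hAK'⟩ :=
    hB.exists_nnnorm_le_and_abs_lpNorm_sub_lpNorm_sub_le hS hE hΩ hcons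
  refine ⟨K * A ^ 2 + K', fun θ η₁ η₂ h₁ h₂ => ?_⟩
  obtain ⟨ζ, hζ, hζθ₂⟩ := hS.exists_exp_eq _ (hS.riemExp_mem h₁) _ (hS.riemExp_mem h₂)
  obtain ⟨hζA, hcompare⟩ := hAK' θ η₁ η₂ ζ h₁ h₂ hζ hζθ₂
  obtain ⟨hfin, hdist⟩ := hK _ ζ hζ
  rw [hζθ₂] at hfin hdist
  have hζ₂ : (K : ℝ) * ‖ζ‖ ^ 2 ≤ K * A ^ 2 * (‖η₁‖ + ‖η₂‖) ^ 2 := by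
    rw [mul_assoc, ← mul_pow]
    gcongr
    exact hζA
  refine ⟨hfin, (abs_sub_le _ _ _).trans ((add_le_add (hdist.trans hζ₂) hcompare).trans_eq ?_)⟩
  push_cast
  ring

lemma hasDerivWithinAt_zero_of_abs_sub_le {f : ℝ → ℝ} {c K : ℝ} {s : Set ℝ} (hs : 0 ∈ s)
    (h : ∀ t ∈ s, |f t - t * c| ≤ t ^ 2 * K) : HasDerivWithinAt f c s 0 := by
  have hf₀ : f 0 = 0 := by simpa using h 0 hs
  have hO : (fun t => f t - f 0 - (t - 0) • c) =O[𝓝[s] 0] fun t : ℝ => t ^ 2 := by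
    refine .of_bound K (eventually_nhdsWithin_of_forall fun t ht => ?_)
    simpa [hf₀, mul_comm K] using h t ht
  have ho : (fun t : ℝ => t ^ 2) =o[𝓝[s] 0] fun t : ℝ => t - 0 := by
    simpa using (Asymptotics.isLittleO_pow_pow (𝕜 := ℝ) one_lt_two).mono nhdsWithin_le_nhds
  exact hasDerivWithinAt_iff_isLittleO.2 (hO.trans_isLittleO ho)

end GeodesicRestriction

end WassersteinSubmanifold

end

open WassersteinSubmanifold in
theorem mainTheorem1_general
    {d : ℕ}
    {F : Type*} [NormedAddCommGroup F] [NormedSpace ℝ F]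
    {M : Type*} [TopologicalSpace M] [ChartedSpace F M] [IsManifold 𝓘(ℝ, F) ∞ M]
    [RiemannianBundle (fun x : M => TangentSpace 𝓘(ℝ, F) x)]
    [IsContMDiffRiemannianBundle 𝓘(ℝ, F) ∞ F (fun x : M => TangentSpace 𝓘(ℝ, F) x)]
    {Ω : Set (Eucl d)} (hΩ : IsCompact Ω)
    {S : Set M} {D : Set (TangentBundle 𝓘(ℝ, F) M)} (hS : IsParameterManifold S D)
    {E : M → Measure (Eucl d)} (hE : IsEmbeddingOn (F := F) Ω S E)
    {B : ∀ θ : M, TangentSpace 𝓘(ℝ, F) θ →ₗ[ℝ] (Eucl d → Eucl d)}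
    (hB : IsVelocityFamily S D E B) (hcons : IsConsistent Ω S E B) :
    ∃ C : ℝ, 0 < C ∧ ∀ (θ : M) (η₁ η₂ : TangentSpace 𝓘(ℝ, F) θ),
      (⟨θ, η₁⟩ : TangentBundle 𝓘(ℝ, F) M) ∈ D → (⟨θ, η₂⟩ : TangentBundle 𝓘(ℝ, F) M) ∈ D →
      (∀ t ∈ Icc (0 : ℝ) 1,
        geodRestrEDist (E '' S) (E (expCurve θ η₁ t)) (E (expCurve θ η₂ t)) ≠ ⊤) ∧
      (∀ t ∈ Icc (0 : ℝ) 1,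
        |(geodRestrEDist (E '' S) (E (expCurve θ η₁ t)) (E (expCurve θ η₂ t))).toReal
          - t * lpNorm (B θ (η₁ - η₂)) 2 (E θ)| ≤ t ^ 2 * C * (‖η₁‖ + ‖η₂‖) ^ 2) ∧
      HasDerivWithinAt
        (fun t : ℝ =>
          (geodRestrEDist (E '' S) (E (expCurve θ η₁ t)) (E (expCurve θ η₂ t))).toReal)
        (lpNorm (B θ (η₁ - η₂)) 2 (E θ)) (Icc 0 1) 0 := by
  obtain ⟨K, hK⟩ := hB.exists_abs_geodRestrEDist_riemExp_riemExp_sub_le hS hE hΩ hcons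
  refine ⟨K + 1, by positivity, fun θ η₁ η₂ h₁ h₂ => ?_⟩
  have hscale := fun t ht =>
    hK θ (t • η₁) (t • η₂) (hS.smul_mem θ η₁ h₁ t ht) (hS.smul_mem θ η₂ h₂ t ht)
  have hbound : ∀ t ∈ Icc (0 : ℝ) 1,
      |(geodRestrEDist (E '' S) (E (expCurve θ η₁ t)) (E (expCurve θ η₂ t))).toReal
        - t * lpNorm (B θ (η₁ - η₂)) 2 (E θ)| ≤ t ^ 2 * (K + 1) * (‖η₁‖ + ‖η₂‖) ^ 2 := by
    intro t ht
    have hle := (hscale t ht).2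
    rw [← smul_sub, map_smul, lpNorm_const_smul, norm_smul, norm_smul, coe_nnnorm,
      Real.norm_of_nonneg ht.1, ← mul_add, mul_pow] at hle
    refine hle.trans ?_
    rw [mul_left_comm, mul_assoc]
    gcongr
    exact le_add_of_nonneg_right zero_le_one
  exact ⟨fun t ht => (hscale t ht).1, hbound, hasDerivWithinAt_zero_of_abs_sub_le (by simp)
    fun t ht => (hbound t ht).trans_eq (mul_assoc _ _ _)⟩

theorem mainTheorem1
    {d : ℕ}
    {F : Type*} [NormedAddCommGroup F] [NormedSpace ℝ F] [FiniteDimensional ℝ F]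
    {M : Type*} [TopologicalSpace M] [T2Space M]
    [ChartedSpace F M]
    [IsManifold 𝓘(ℝ, F) ∞ M]
    [RiemannianBundle (fun x : M => TangentSpace 𝓘(ℝ, F) x)]
    [IsContMDiffRiemannianBundle 𝓘(ℝ, F) ∞ F (fun x : M => TangentSpace 𝓘(ℝ, F) x)]
    (Ω : Set (WassersteinSubmanifold.Eucl d)) (hΩc : IsCompact Ω) (hΩ : Convex ℝ Ω)
    (S : Set M) (D : Set (TangentBundle 𝓘(ℝ, F) M))
    (hS : WassersteinSubmanifold.IsParameterManifold S D)
    (E : M → Measure (WassersteinSubmanifold.Eucl d))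
    (hE : WassersteinSubmanifold.IsEmbeddingOn (F := F) Ω S E)
    (B : ∀ θ : M, TangentSpace 𝓘(ℝ, F) θ →ₗ[ℝ]
      (WassersteinSubmanifold.Eucl d → WassersteinSubmanifold.Eucl d))
    (hB : WassersteinSubmanifold.IsVelocityFamily S D E B)
    (hcons : WassersteinSubmanifold.IsConsistent Ω S E B) :
    ∃ C : ℝ, 0 < C ∧
      ∀ (θ : M) (η₁ η₂ : TangentSpace 𝓘(ℝ, F) θ),
        (⟨θ, η₁⟩ : TangentBundle 𝓘(ℝ, F) M) ∈ D → (⟨θ, η₂⟩ : TangentBundle 𝓘(ℝ, F) M) ∈ D →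
        -- `W_Λ` is finite along the two curves, so that its real value is meaningful
        (∀ t ∈ Icc (0 : ℝ) 1,
          WassersteinSubmanifold.geodRestrEDist (E '' S)
            (E (WassersteinSubmanifold.expCurve θ η₁ t))
            (E (WassersteinSubmanifold.expCurve θ η₂ t)) ≠ ⊤) ∧
        -- `0 ≤ t < min {1, 1 / (C ‖η₁‖), 1 / (C ‖η₂‖)}`, where `1 / 0 = ∞`
        (∀ t : ℝ, 0 ≤ t → t < 1 → t * (C * ‖η₁‖) < 1 → t * (C * ‖η₂‖) < 1 →
          |(WassersteinSubmanifold.geodRestrEDist (E '' S)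
              (E (WassersteinSubmanifold.expCurve θ η₁ t))
              (E (WassersteinSubmanifold.expCurve θ η₂ t))).toReal
            - t * lpNorm (B θ (η₁ - η₂)) 2 (E θ)|
          ≤ t ^ 2 * C * (‖η₁‖ + ‖η₂‖) ^ 2) ∧
        HasDerivWithinAt
          (fun t : ℝ => (WassersteinSubmanifold.geodRestrEDist (E '' S)
            (E (WassersteinSubmanifold.expCurve θ η₁ t))
            (E (WassersteinSubmanifold.expCurve θ η₂ t))).toReal)
          (lpNorm (B θ (η₁ - η₂)) 2 (E θ)) (Icc 0 1) 0 := by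
  obtain ⟨C, hC, h⟩ := mainTheorem1_general hΩc hS hE hB hcons
  refine ⟨C, hC, fun θ η₁ η₂ h₁ h₂ => ?_⟩
  obtain ⟨hfin, hle, hderiv⟩ := h θ η₁ η₂ h₁ h₂
  exact ⟨hfin, fun t ht₀ ht₁ _ _ => hle t ⟨ht₀, ht₁.le⟩, hderiv⟩
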